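/- Let $\mathfrak g$ be a complex finite-dimensional simple Lie algebra with simple roots $\alpha_i$ $(i\in I)$, Cartan matrix $\mathsf C=(c_{i,j})$, $c_{i,j}=\langle h_i,\alpha_j\rangle$, and minimal symmetrizer $(d_i)_{i\in I}$ ($d_i\in\mathbb Z_{\ge1}$, $\min_i d_i=1$), so that $(\alpha_i,\alpha_j)=d_ic_{i,j}=d_jc_{j,i}$. Let $s_i(\alpha_j)=\alpha_j-c_{i,j}\alpha_i$ be the simple reflections, $\mathsf W$ the Weyl group they generate, and $w_\circ$ its longest element. Put $q_i=q^{d_i}$, $[n]_i=\frac{q_i^n-q_i^{-n}}{q_i-q_i^{-1}}$, $[n]_i!=\prod_{k=1}^n[k]_i$, and $\left[{n\atop s}\right]_i=\frac{[n]_i!}{[s]_i!\,[n-s]_i!}$. Let $\widehat{\mathcal A}_q(\mathfrak n)$ be the $\mathbb Q(q^{1/2})$-algebra generated by $y_{i,m}$ $(i\in I,\ m\in\mathbb Z)$ with the relations $$\sum_{s=0}^{1-c_{i,j}}(-1)^s\left[{1-c_{i,j}\atop s}\right]_i y_{i,k}^{1-c_{i,j}-s}\,y_{j,k}\,y_{i,k}^{s}=0\quad(i\ne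 j),$$ $$y_{i,k}y_{j,k+1}=q^{(\alpha_i,\alpha_j)}y_{j,k+1}y_{i,k}+\delta_{i,j}\bigl(1-q^{(\alpha_i,\alpha_i)}\bigr),$$ $$y_{i,k}y_{j,l}=q^{-(-1)^{k+l}(\alpha_i,\alpha_j)}y_{j,l}y_{i,k}\quad(l>k+1),$$ and let $\widehat{\mathcal A}_q(\mathfrak n)_m$ be the subalgebra generated by the $y_{i,m}$, $i\in I$. Write $y_{i,m}^{(k)}=y_{i,m}^k/[k]_i!$. Then there are (necessarily unique) algebra automorphisms $T_i$ $(i\in I)$ of $\widehat{\mathcal A}_q(\mathfrak n)$ such that, for all $j\in I$ and $m\in\mathbb Z$: if $c_{i,j}\ge0$, then $T_i^{\pm1}(y_{j,m})=y_{j,m\pm\delta_{i,j}}$; and if $c_{i,j}<0$, then $$T_i(y_{j,m})=\frac{\sum_{k=0}^{-c_{i,j}}(-1)^kq_i^{-c_{i,j}/2-k}\,y_{i,m}^{(k)}\,y_{j,m}\,y_{i,m}^{(-c_{i,j}-k)}}{(q_i-q_i^{-1})^{-c_{i,j}}},\qquad T_i^{-1}(y_{j,m})=\frac{\sum_{k=0}^{-c_{i,j}}(-1)^kq_i^{-c_{i,j}/2-k}\,y_{i,m}^{(-c_{i,j}-k)}\,y_{j,m}\,y_{i,m}^{(k)}}{(q_i-q_i^{-1})^{-c_{i,j}}}.$$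 These automorphisms satisfy the following. (a) If $s_{i_1}\cdots s_{i_{r-1}}s_{i_r}$ is a reduced expression of an element of $\mathsf W$ and $s_{i_1}\cdots s_{i_{r-1}}(\alpha_{i_r})=\alpha_j$, then for all $m\in\mathbb Z$ $$T_{i_1}^{\pm1}\cdots T_{i_{r-1}}^{\pm1}(y_{i_r,m})=y_{j,m}.$$ (b) Let $i\mapsto i^*$ be the map $I\to I$ with $w_\circ(\alpha_i)=-\alpha_{i^*}$. For every reduced expression $w_\circ=s_{i_1}\cdots s_{i_\ell}$, with $T_{w_\circ}^{\pm1}:=T_{i_1}^{\pm1}\cdots T_{i_\ell}^{\pm1}$, and all $i\in I$, $m\in\mathbb Z$, $$T_{w_\circ}^{\pm1}(y_{i,m})=y_{i^*,m\pm1}\in\widehat{\mathcal A}_q(\mathfrak n)_{m\pm1}.$$ -/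

import Mathlib

noncomputable section

/-- A Cartan datum of a complex finite-dimensional simple Lie algebra with simple roots indexed
by `I`: an indecomposable Cartan matrix `C` of finite type, `C i j = ⟨h_i, α_j⟩`, together with
its minimal symmetrizer `d`, so that `(α_i, α_j) = d i * C i j` and the shortest simple roots
satisfy `(α_i, α_i) = 2`. -/
structure SimpleCartanDatum (I : Type*) [Fintype I] where
  /-- the Cartan matrix -/
  C : Matrix I I ℤ
  /-- the diagonal of the symmetrizer -/
  d : I → ℕ
  diag : ∀ i, C i i = 2
  off_diag : ∀ i j, i ≠ j → C i j ≤ 0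
  d_pos : ∀ i, 0 < d i
  d_min : ∃ i, d i = 1
  symm : ∀ i j, (d i : ℤ) * C i j = (d j : ℤ) * C j i
  /-- finite type: the form `(·, ·)` is positive definite on the root lattice -/
  pos_def : ∀ x : I → ℤ, x ≠ 0 → 0 < ∑ i, ∑ j, (d i : ℤ) * C i j * x i * x j
  /-- simplicity: the Dynkin diagram is connected -/
  indecomposable : ∀ S : Set I, S.Nonempty → Sᶜ.Nonempty → ∃ i ∈ S, ∃ j ∈ Sᶜ, C i j ≠ 0

namespace SimpleCartanDatum

variable {I : Type*} [Fintype I] [DecidableEq I] (D : SimpleCartanDatum I)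

/-! ### Root lattice and Weyl group -/

/-- The simple root `α_i` in the root lattice `⨁ ℤ α_i = (I → ℤ)`. -/
def simpleRoot (_D : SimpleCartanDatum I) (i : I) : I → ℤ := Pi.single i 1

/-- The simple coroot `h_i` as a linear form on the root lattice, `⟨h_i, α_j⟩ = C i j`. -/
def simpleCoroot (i : I) : Module.Dual ℤ (I → ℤ) := ∑ j, D.C i j • LinearMap.proj j

lemma simpleCoroot_simpleRoot (i j : I) : D.simpleCoroot i (D.simpleRoot j) = D.C i j := by
  simp [simpleCoroot, simpleRoot, Pi.single_apply]

/-- The simple reflection `s_i(x) = x - ⟨h_i, x⟩ α_i`. -/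
def simpleReflection (i : I) : (I → ℤ) ≃ₗ[ℤ] (I → ℤ) :=
  Module.reflection (x := D.simpleRoot i) (f := D.simpleCoroot i)
    ((D.simpleCoroot_simpleRoot i i).trans (D.diag i))

/-- The Weyl group, generated by the simple reflections. -/
def weylGroup : Subgroup ((I → ℤ) ≃ₗ[ℤ] (I → ℤ)) :=
  Subgroup.closure (Set.range D.simpleReflection)

/-- The product `s_{i_1} ⋯ s_{i_r}` of a word `(i_1, …, i_r)`. -/
def wordProd (l : List I) : (I → ℤ) ≃ₗ[ℤ] (I → ℤ) := (l.map D.simpleReflection).prod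

/-- `l ∈ I(w)`: the word `l` is a reduced expression of `w`. -/
def IsReducedWord (w : (I → ℤ) ≃ₗ[ℤ] (I → ℤ)) (l : List I) : Prop :=
  D.wordProd l = w ∧ ∀ l' : List I, D.wordProd l' = w → l.length ≤ l'.length

/-- The length `ℓ(w)` of an element of the Weyl group: the least number of factors in an
expression of `w` as a product of simple reflections. -/
def length (w : (I → ℤ) ≃ₗ[ℤ] (I → ℤ)) : ℕ :=
  sInf {n | ∃ l : List I, l.length = n ∧ D.wordProd l = w}

/-- `w` is the longest element `w_∘` of the Weyl group. -/
def IsLongest (w : (I → ℤ) ≃ₗ[ℤ] (I → ℤ)) : Prop :=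
  w ∈ D.weylGroup ∧ ∀ w' ∈ D.weylGroup, D.length w' ≤ D.length w

/-! ### The base field `ℚ(q^{1/2})` and quantum integers -/

/-- The field `ℚ(q^{1/2})`. -/
abbrev QField : Type := RatFunc ℚ

/-- `qHalf e = (q^{1/2})^e = q^{e/2}`. -/
def qHalf (e : ℤ) : QField := (RatFunc.X : RatFunc ℚ) ^ e

/-- `q^e`. -/
def qPow (e : ℤ) : QField := qHalf (2 * e)

/-- `(α_i, α_j)`. -/
def form (i j : I) : ℤ := (D.d i : ℤ) * D.C i j

/-- `q_i - q_i^{-1}` where `q_i = q^{d_i}`. -/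
def qDiff (i : I) : QField := qPow (D.d i) - qPow (-(D.d i : ℤ))

/-- `[n]_i = (q_i^n - q_i^{-n}) / (q_i - q_i^{-1})`. -/
def qInt (i : I) (n : ℕ) : QField :=
  (qPow ((D.d i : ℤ) * n) - qPow (-((D.d i : ℤ) * n))) / D.qDiff i

/-- `[n]_i! = [1]_i ⋯ [n]_i`. -/
def qFactorial (i : I) (n : ℕ) : QField := ∏ k ∈ Finset.range n, D.qInt i (k + 1)

/-- The quantum binomial coefficient (used for `m ≤ n`). -/
def qBinom (i : I) (n m : ℕ) : QField :=
  D.qFactorial i n / (D.qFactorial i m * D.qFactorial i (n - m))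

/-- `-c_{i,j}` as a natural number, for `i ≠ j`. -/
def negC (i j : I) : ℕ := (-D.C i j).toNat

/-! ### The algebra `Â_q(𝔫)` -/

/-- The free generator that is mapped to `y_{i,m}`. -/
def gen (_D : SimpleCartanDatum I) (i : I) (m : ℤ) : FreeAlgebra QField (I × ℤ) :=
  FreeAlgebra.ι QField (i, m)

/-- The defining relations: the quantum Serre relations in each level, and the quantum boson
relations between different levels. -/
inductive Rel : FreeAlgebra QField (I × ℤ) → FreeAlgebra QField (I × ℤ) → Prop
  | serre (i j : I) (k : ℤ) (hij : i ≠ j) :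
      Rel (∑ s ∈ Finset.range (D.negC i j + 2),
            ((-1) ^ s * D.qBinom i (D.negC i j + 1) s) •
              (D.gen i k ^ (D.negC i j + 1 - s) * D.gen j k * D.gen i k ^ s)) 0
  | boson_same (i : I) (k : ℤ) :
      Rel (D.gen i k * D.gen i (k + 1))
        (qPow (D.form i i) • (D.gen i (k + 1) * D.gen i k) +
          algebraMap QField _ (1 - qPow (D.form i i)))
  | boson_next (i j : I) (k : ℤ) (hij : i ≠ j) :
      Rel (D.gen i k * D.gen j (k + 1))
        (qPow (D.form i j) • (D.gen j (k + 1) * D.gen i k))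
  | boson_far (i j : I) (k l : ℤ) (hkl : k + 1 < l) :
      Rel (D.gen i k * D.gen j l)
        (qPow (((k + l + 1).negOnePow : ℤ) * D.form i j) • (D.gen j l * D.gen i k))

/-- The `ℚ(q^{1/2})`-algebra `Â_q(𝔫)`. -/
abbrev AHat : Type _ := RingQuot D.Rel

/-- The generators `y_{i,m}` of `Â_q(𝔫)`. -/
def y (i : I) (m : ℤ) : D.AHat := RingQuot.mkAlgHom QField D.Rel (D.gen i m)

/-- The divided power `y_{i,m}^{(k)} = y_{i,m}^k / [k]_i!`. -/
def yDiv (i : I) (m : ℤ) (k : ℕ) : D.AHat := (D.qFactorial i k)⁻¹ • D.y i m ^ k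

/-- The subalgebra `Â_q(𝔫)_m` generated by the `y_{i,m}`, `i ∈ I`. -/
def level (m : ℤ) : Subalgebra QField D.AHat := Algebra.adjoin QField (Set.range fun i => D.y i m)

/-! ### The braid symmetries on generators -/

/-- The element prescribed for `T_i(y_{j,m})`; here `q_i^{-c/2 - k} = (q^{1/2})^{d_i (-c - 2k)}`. -/
def braidImage (i j : I) (m : ℤ) : D.AHat :=
  if 0 ≤ D.C i j then D.y j (m + if i = j then 1 else 0)
  else (D.qDiff i ^ D.negC i j)⁻¹ • ∑ k ∈ Finset.range (D.negC i j + 1),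
    ((-1) ^ k * qHalf ((D.d i : ℤ) * (D.negC i j - 2 * k))) •
      (D.yDiv i m k * D.y j m * D.yDiv i m (D.negC i j - k))

/-- The element prescribed for `T_i⁻¹(y_{j,m})`. -/
def braidInvImage (i j : I) (m : ℤ) : D.AHat :=
  if 0 ≤ D.C i j then D.y j (m - if i = j then 1 else 0)
  else (D.qDiff i ^ D.negC i j)⁻¹ • ∑ k ∈ Finset.range (D.negC i j + 1),
    ((-1) ^ k * qHalf ((D.d i : ℤ) * (D.negC i j - 2 * k))) •
      (D.yDiv i m (D.negC i j - k) * D.y j m * D.yDiv i m k)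

/-- `T` is the family of automorphisms `T_i` of `Â_q(𝔫)` with the prescribed values of `T_i` and
`T_i⁻¹` on the generators; there is at most one such family. -/
def IsBraidFamily (T : I → (D.AHat ≃ₐ[QField] D.AHat)) : Prop :=
  ∀ (i j : I) (m : ℤ),
    T i (D.y j m) = D.braidImage i j m ∧ (T i).symm (D.y j m) = D.braidInvImage i j m

/-- `T_{i_1} ∘ ⋯ ∘ T_{i_r}` for a word `(i_1, …, i_r)`. -/
def braidWord (T : I → (D.AHat ≃ₐ[QField] D.AHat)) (l : List I) : D.AHat ≃ₐ[QField] D.AHat :=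
  (l.map T).prod

/-- `T_{i_1}⁻¹ ∘ ⋯ ∘ T_{i_r}⁻¹` for a word `(i_1, …, i_r)`. -/
def braidInvWord (T : I → (D.AHat ≃ₐ[QField] D.AHat)) (l : List I) : D.AHat ≃ₐ[QField] D.AHat :=
  (l.map fun i => (T i).symm).prod

end SimpleCartanDatum

end

/-!
Up to normalization, `T_i (y_{j,m})` with `i ≠ j` is the iterated `q`-commutator of `y_{j,m}` with
`y_{i,m}` of the highest order `-c_{i,j}` that does not vanish by the Serre relation. By the
`q`-Leibniz rule, normalized top commutators are multiplicative, so any relation among the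
`y_{j,m}` with `j ≠ i` is inherited by their images; the relations involving `y_{i,m}` come from
commuting the bosonic pair `y_{i,m}`, `y_{i,m+1}` past iterated commutators. The anti-automorphism
`y_{i,m} ↦ y_{i,-m}` conjugates `T_i` to its inverse.

For `i ≠ j`, the automorphism `T_i` sends the mirrored commutator of order `s` of `y_{j,m}` with
`y_{i,m}` to a multiple of the commutator of order `-c_{i,j} - s`. This computes alternating words
in `T_i` and `T_j` on `y_i` and `y_j`, and yields the braid relations. By Matsumoto's theorem a
product of the `T_i` along a reduced word only depends on the Weyl group element. If `w α_i = α_j`,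
splitting off the dihedral part of `w` reduces `T_w (y_{i,m}) = y_{j,m}` to rank two. A reduced word
of `w_∘` can be chosen to end in any `i`, and `T_i (y_{i,m}) = y_{i,m+1}` produces the level shift.
-/

noncomputable section

namespace SimpleCartanDatum

open CoxeterSystem (alternatingWord alternatingWord_succ alternatingWord_succ'
  length_alternatingWord)

/-! ### Cartan matrices of finite type -/

section CartanMatrix

variable {I : Type*} [Fintype I] (D : SimpleCartanDatum I)

lemma form_comm (i j : I) : D.form i j = D.form j i := D.symm i j

lemma form_self (i : I) : D.form i i = 2 * D.d i := by rw [form, D.diag, mul_comm]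

variable {D} in
lemma C_eq_zero_symm {i j : I} (h : D.C i j = 0) : D.C j i = 0 := by
  have hsymm := D.symm j i
  rw [h, mul_zero] at hsymm
  exact (mul_eq_zero.mp hsymm).resolve_left (Nat.cast_ne_zero.mpr (D.d_pos j).ne')

/-- The order of `s_i s_j` for `i ≠ j`, read off from the Cartan matrix. -/
def braidOrder (i j : I) : ℕ :=
  if D.C i j * D.C j i = 0 then 2 else if D.C i j * D.C j i = 1 then 3
  else if D.C i j * D.C j i = 2 then 4 else 6

lemma braidOrder_comm (i j : I) : D.braidOrder i j = D.braidOrder j i := by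
  simp only [braidOrder, mul_comm (D.C i j)]

lemma braidOrder_pos (i j : I) : 0 < D.braidOrder i j := by
  unfold braidOrder; split_ifs <;> norm_num

end CartanMatrix

section RootForm

variable {I : Type*} [Fintype I] [DecidableEq I] (D : SimpleCartanDatum I)

/-- The invariant symmetric bilinear form `(·, ·)` on the root lattice. -/
def rootForm : LinearMap.BilinForm ℤ (I → ℤ) := Matrix.toBilin' (Matrix.of D.form)

@[simp] lemma rootForm_simpleRoot (i j : I) :
    D.rootForm (D.simpleRoot i) (D.simpleRoot j) = D.form i j :=
  Matrix.toBilin'_single _ i j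

lemma rootForm_self_pos {x : I → ℤ} (hx : x ≠ 0) : 0 < D.rootForm x x := by
  refine (D.pos_def x hx).trans_eq ?_
  simp only [rootForm, Matrix.toBilin'_apply, Matrix.of_apply, form]
  exact Finset.sum_congr rfl fun i _ => Finset.sum_congr rfl fun j _ => by ring

end RootForm

section FiniteType

variable {I : Type*} [Fintype I] {D : SimpleCartanDatum I}

variable (D) in
/-- Positivity of the form on `2 α_j - c_{i,j} α_i`. -/
lemma C_mul_C_lt_four {i j : I} (hij : i ≠ j) : D.C i j * D.C j i < 4 := by
  classical
  have hne : (2 : ℤ) • D.simpleRoot j - D.C i j • D.simpleRoot i ≠ 0 := fun h => by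
    simpa [simpleRoot, hij.symm] using congrFun h j
  have hpos := D.rootForm_self_pos hne
  simp only [map_sub, map_smul, LinearMap.sub_apply, LinearMap.smul_apply, rootForm_simpleRoot,
    form_self, D.form_comm j i, smul_eq_mul] at hpos
  have hform : D.form i j * D.C i j = D.d j * (D.C i j * D.C j i) := by
    rw [form_comm, form]; ring
  have hself : D.C i j * (D.d i * D.C i j) = D.form i j * D.C i j := by rw [form]; ring
  refine lt_of_mul_lt_mul_left ?_ (Nat.cast_nonneg (D.d j))
  linarith

/-- Positivity of the form on `2 α_j - c_{i,j} α_i - c_{k,j} α_k`. -/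
lemma C_mul_C_add_C_mul_C_lt_four {i j k : I} (hij : i ≠ j) (hik : i ≠ k) (hjk : j ≠ k) :
    D.C i j * D.C j i + D.C j k * D.C k j < 4 := by
  classical
  have hne : (2 : ℤ) • D.simpleRoot j - D.C i j • D.simpleRoot i - D.C k j • D.simpleRoot k ≠ 0 :=
    fun h => by simpa [simpleRoot, hij.symm, hjk] using congrFun h j
  have hpos := D.rootForm_self_pos hne
  simp only [map_sub, map_smul, LinearMap.sub_apply, LinearMap.smul_apply, rootForm_simpleRoot,
    form_self, D.form_comm j i, D.form_comm j k, D.form_comm k i, smul_eq_mul] at hpos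
  have hform : D.form i j * D.C i j = D.d j * (D.C i j * D.C j i) := by
    rw [form_comm, form]; ring
  have hform' : D.form k j * D.C k j = D.d j * (D.C j k * D.C k j) := by
    rw [form_comm, form]; ring
  have hself : D.C i j * (D.d i * D.C i j) = D.form i j * D.C i j := by rw [form]; ring
  have hself' : D.C k j * (D.d k * D.C k j) = D.form k j * D.C k j := by rw [form]; ring
  have hcross : D.form i k * (D.C i j * D.C k j) ≤ 0 :=
    mul_nonpos_of_nonpos_of_nonneg
      (mul_nonpos_of_nonneg_of_nonpos (Nat.cast_nonneg _) (D.off_diag i k hik))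
      (mul_nonneg_of_nonpos_of_nonpos (D.off_diag i j hij) (D.off_diag k j hjk.symm))
  refine lt_of_mul_lt_mul_left ?_ (Nat.cast_nonneg (D.d j))
  linarith

/-- Positivity of the form on `α_i + α_j + α_k` excludes triangles in the Dynkin diagram. -/
lemma C_eq_zero_of_ne_zero_of_ne_zero {i j k : I} (hij : i ≠ j) (hik : i ≠ k) (hjk : j ≠ k)
    (h₁ : D.C i j ≠ 0) (h₂ : D.C j k ≠ 0) : D.C i k = 0 := by
  classical
  by_contra h₃
  have hne : D.simpleRoot i + D.simpleRoot j + D.simpleRoot k ≠ 0 := fun h => by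
    simpa [simpleRoot, hij, hik] using congrFun h i
  have hpos := D.rootForm_self_pos hne
  simp only [map_add, LinearMap.add_apply, rootForm_simpleRoot, form_self, D.form_comm j i,
    D.form_comm k j, D.form_comm i k] at hpos
  have form_le (a b : I) (hab : a ≠ b) (h : D.C a b ≠ 0) : D.form a b ≤ -D.d a := by
    have hC := D.off_diag a b hab
    rw [form, ← mul_neg_one]
    exact mul_le_mul_of_nonneg_left (by lia) (Nat.cast_nonneg _)
  have := form_le i j hij h₁
  have := form_le j k hjk h₂
  have := form_le k i hik.symm (mt C_eq_zero_symm h₃)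
  linarith

variable (D) in
lemma cartan_cases {i j : I} (hij : i ≠ j) :
    (D.C i j = 0 ∧ D.C j i = 0) ∨ (D.C i j = -1 ∧ D.C j i = -1) ∨
    (D.C i j = -1 ∧ D.C j i = -2) ∨ (D.C i j = -2 ∧ D.C j i = -1) ∨
    (D.C i j = -1 ∧ D.C j i = -3) ∨ (D.C i j = -3 ∧ D.C j i = -1) := by
  by_cases h : D.C i j = 0
  · exact Or.inl ⟨h, C_eq_zero_symm h⟩
  have hneg : D.C i j ≤ -1 := by have := D.off_diag i j hij; lia
  have hneg' : D.C j i ≤ -1 := by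
    have := D.off_diag j i hij.symm
    have := mt C_eq_zero_symm h
    lia
  have hlt := D.C_mul_C_lt_four hij
  generalize D.C i j = x at *
  generalize D.C j i = y at *
  have : -3 ≤ x := by nlinarith
  have : -3 ≤ y := by nlinarith
  interval_cases x <;> interval_cases y <;> simp_all

end FiniteType

section Dihedral

lemma exists_append_alternatingWord_eq {I : Type*} (i j : I) {k n : ℕ} (h : k ≤ n) :
    ∃ p, p ++ alternatingWord i j k = alternatingWord i j n := by
  induction n, h using Nat.le_induction with
  | base => exact ⟨[], rfl⟩
  | succ n _ ih =>
    obtain ⟨p, hp⟩ := ih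
    exact ⟨(if Even n then j else i) :: p, by rw [alternatingWord_succ', ← hp, List.cons_append]⟩

/-- The coordinates of `⋯ s_i s_j (α_i)` (`n` factors) in the basis `α_i, α_j`, where
`a = -c_{i,j}` and `b = -c_{j,i}`. -/
def dihedralCoeff (a b : ℤ) : ℕ → ℤ × ℤ
  | 0 => (1, 0)
  | n + 1 => if Even n then ((dihedralCoeff a b n).1, b * (dihedralCoeff a b n).1 -
        (dihedralCoeff a b n).2)
      else (a * (dihedralCoeff a b n).2 - (dihedralCoeff a b n).1, (dihedralCoeff a b n).2)

variable {I : Type*} [Fintype I] {D : SimpleCartanDatum I} {i j : I}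

lemma dihedralCoeff_nonneg (hij : i ≠ j) {n : ℕ} (hn : n < D.braidOrder i j) :
    0 ≤ (dihedralCoeff (-D.C i j) (-D.C j i) n).1 ∧
      0 ≤ (dihedralCoeff (-D.C i j) (-D.C j i) n).2 := by
  rcases D.cartan_cases hij with h | h | h | h | h | h <;> obtain ⟨hC, hC'⟩ := h <;>
    simp only [hC, hC', braidOrder] at hn ⊢ <;> norm_num at hn ⊢ <;>
    interval_cases n <;> simp [dihedralCoeff, Nat.even_iff]

lemma dihedralCoeff_of_eq_zero (hij : i ≠ j) {n : ℕ} (hn : n < D.braidOrder i j) (hn₀ : 0 < n)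
    (h : (dihedralCoeff (-D.C i j) (-D.C j i) n).1 = 0 ∨
      (dihedralCoeff (-D.C i j) (-D.C j i) n).2 = 0) :
    n = D.braidOrder i j - 1 ∧
      dihedralCoeff (-D.C i j) (-D.C j i) n = if D.braidOrder i j = 3 then (0, 1) else (1, 0) := by
  rcases D.cartan_cases hij with hC | hC | hC | hC | hC | hC <;> obtain ⟨hC, hC'⟩ := hC <;>
    simp only [hC, hC', braidOrder] at hn h ⊢ <;> norm_num at hn h ⊢ <;>
    interval_cases n <;> simp [dihedralCoeff, Nat.even_iff] at h ⊢

end Dihedral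

section Height

variable {I : Type*} [Fintype I]

/-- The height of an element of the root lattice: the sum of its coordinates. -/
def height : (I → ℤ) →ₗ[ℤ] ℤ := ∑ i, LinearMap.proj i

lemma height_apply (x : I → ℤ) : height x = ∑ i, x i := by simp [height]

lemma one_le_height {x : I → ℤ} (hx : 0 ≤ x) (hne : x ≠ 0) : 1 ≤ height x := by
  obtain ⟨i, hi⟩ := Function.ne_iff.mp hne
  rw [height_apply]
  exact Finset.sum_pos' (fun j _ => hx j)
    ⟨i, Finset.mem_univ i, lt_of_le_of_ne (hx i) (Ne.symm hi)⟩

end Height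

variable {I : Type*} [Fintype I] [DecidableEq I] (D : SimpleCartanDatum I)

/-! ### Simple reflections and reduced words -/

@[simp] lemma simpleReflection_apply (i : I) (x : I → ℤ) :
    D.simpleReflection i x = x - D.simpleCoroot i x • D.simpleRoot i := rfl

lemma simpleReflection_mul_self (i : I) :
    D.simpleReflection i * D.simpleReflection i = 1 :=
  LinearEquiv.ext (Module.involutive_reflection _)

lemma simpleReflection_simpleRoot (i j : I) :
    D.simpleReflection i (D.simpleRoot j) = D.simpleRoot j - D.C i j • D.simpleRoot i := by
  rw [simpleReflection_apply, simpleCoroot_simpleRoot]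

lemma simpleReflection_simpleRoot_self (i : I) :
    D.simpleReflection i (D.simpleRoot i) = -D.simpleRoot i := by
  rw [simpleReflection_simpleRoot, D.diag]; module

lemma simpleRoot_ne_zero (i : I) : D.simpleRoot i ≠ 0 := by
  simp [simpleRoot]

lemma map_simpleRoot_ne_zero (w : (I → ℤ) ≃ₗ[ℤ] (I → ℤ)) (i : I) : w (D.simpleRoot i) ≠ 0 :=
  w.map_ne_zero_iff.mpr (D.simpleRoot_ne_zero i)

@[simp] lemma wordProd_nil : D.wordProd [] = 1 := rfl

@[simp] lemma wordProd_cons (i : I) (l : List I) :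
    D.wordProd (i :: l) = D.simpleReflection i * D.wordProd l := by simp [wordProd]

@[simp] lemma wordProd_append (l l' : List I) :
    D.wordProd (l ++ l') = D.wordProd l * D.wordProd l' := by simp [wordProd]

lemma wordProd_append_singleton (l : List I) (i : I) :
    D.wordProd (l ++ [i]) = D.wordProd l * D.simpleReflection i := by simp

lemma wordProd_append_singleton_eq_iff {w : (I → ℤ) ≃ₗ[ℤ] (I → ℤ)} {l : List I} {i : I} :
    D.wordProd (l ++ [i]) = w ↔ D.wordProd l = w * D.simpleReflection i := by
  have hinv : (D.simpleReflection i)⁻¹ = D.simpleReflection i :=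
    inv_eq_of_mul_eq_one_left (D.simpleReflection_mul_self i)
  rw [wordProd_append_singleton, ← eq_mul_inv_iff_mul_eq, hinv]

lemma det_simpleReflection (i : I) : LinearEquiv.det (D.simpleReflection i) = -1 := by
  have htransvection : (D.simpleReflection i).toLinearMap =
      LinearMap.transvection (D.simpleCoroot i) (-D.simpleRoot i) :=
    LinearMap.ext fun x => by simp [LinearMap.transvection.apply, sub_eq_add_neg]
  ext
  rw [LinearEquiv.coe_det, htransvection, LinearMap.transvection.det, map_neg,
    simpleCoroot_simpleRoot, D.diag]
  rfl

lemma det_wordProd (l : List I) : LinearEquiv.det (D.wordProd l) = (-1) ^ l.length := by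
  induction l with
  | nil => simp
  | cons i l ih =>
    rw [wordProd_cons, map_mul, det_simpleReflection, ih, List.length_cons, pow_succ']

variable {D} in
lemma even_length_iff_of_wordProd_eq {l l' : List I} (h : D.wordProd l = D.wordProd l') :
    Even l.length ↔ Even l'.length := by
  have hdet : (-1 : ℤˣ) ^ l.length = (-1) ^ l'.length := by rw [← det_wordProd, h, det_wordProd]
  rw [← neg_one_pow_eq_one_iff_even (R := ℤˣ) (by decide), hdet,
    neg_one_pow_eq_one_iff_even (by decide)]

lemma wordProd_mem_weylGroup (l : List I) : D.wordProd l ∈ D.weylGroup :=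
  Subgroup.list_prod_mem _ <| List.forall_mem_map.mpr fun i _ => Subgroup.subset_closure ⟨i, rfl⟩

lemma wordProd_reverse (l : List I) : D.wordProd l.reverse = (D.wordProd l)⁻¹ := by
  induction l with
  | nil => simp
  | cons i l ih =>
    rw [List.reverse_cons, wordProd_append_singleton_eq_iff, ih, wordProd_cons, mul_inv_rev,
      inv_mul_cancel_right]

lemma exists_wordProd_eq {w : (I → ℤ) ≃ₗ[ℤ] (I → ℤ)} (hw : w ∈ D.weylGroup) :
    ∃ l, D.wordProd l = w := by
  induction hw using Subgroup.closure_induction with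
  | mem x hx => obtain ⟨i, rfl⟩ := hx; exact ⟨[i], by simp⟩
  | one => exact ⟨[], rfl⟩
  | mul x y _ _ hx hy =>
    obtain ⟨⟨l, rfl⟩, l', rfl⟩ := And.intro hx hy
    exact ⟨l ++ l', by simp⟩
  | inv x _ hx =>
    obtain ⟨l, rfl⟩ := hx
    exact ⟨l.reverse, D.wordProd_reverse l⟩

lemma exists_isReducedWord {w : (I → ℤ) ≃ₗ[ℤ] (I → ℤ)} (hw : w ∈ D.weylGroup) :
    ∃ l, D.IsReducedWord w l := by
  obtain ⟨l, hl, hmin⟩ := WellFounded.has_min (measure List.length).wf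
    {l | D.wordProd l = w} (D.exists_wordProd_eq hw)
  exact ⟨l, hl, fun l' hl' => not_lt.mp (hmin l' hl')⟩

/-- A word is reduced if it is a reduced expression of its product. -/
abbrev IsReduced (l : List I) : Prop := D.IsReducedWord (D.wordProd l) l

variable {D} {w : (I → ℤ) ≃ₗ[ℤ] (I → ℤ)} {l l' : List I} {i j : I}

lemma IsReducedWord.isReduced (h : D.IsReducedWord w l) : D.IsReduced l := by
  rwa [IsReduced, h.1]

lemma IsReducedWord.length_eq_length (h : D.IsReducedWord w l) (h' : D.IsReducedWord w l') :
    l.length = l'.length :=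
  le_antisymm (h.2 _ h'.1) (h'.2 _ h.1)

lemma IsReducedWord.of_length_le (h : D.IsReducedWord w l) (hw : D.wordProd l' = w)
    (hle : l'.length ≤ l.length) : D.IsReducedWord w l' :=
  ⟨hw, fun l'' hl'' => hle.trans (h.2 l'' hl'')⟩

lemma IsReducedWord.length_eq (h : D.IsReducedWord w l) : D.length w = l.length := by
  refine le_antisymm (Nat.sInf_le ⟨l, rfl, h.1⟩) (le_csInf ⟨_, l, rfl, h.1⟩ ?_)
  rintro _ ⟨l', rfl, hl'⟩
  exact h.2 l' hl'

lemma IsReducedWord.reverse (h : D.IsReducedWord w l) : D.IsReducedWord w⁻¹ l.reverse := by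
  refine ⟨by rw [wordProd_reverse, h.1], fun l' hl' => ?_⟩
  simpa using h.2 l'.reverse (by rw [wordProd_reverse, hl', inv_inv])

lemma IsReduced.left (h : D.IsReduced (l ++ l')) : D.IsReduced l :=
  ⟨rfl, fun l'' hl'' => by simpa using h.2 (l'' ++ l') (by simp [hl''])⟩

lemma IsReduced.right (h : D.IsReduced (l ++ l')) : D.IsReduced l' :=
  ⟨rfl, fun l'' hl'' => by simpa using h.2 (l ++ l'') (by simp [hl''])⟩

lemma IsReduced.wordProd_ne (h : D.IsReduced (l ++ [i])) {p : List I} (hp : p.length ≤ l.length) :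
    D.wordProd l ≠ D.wordProd (p ++ [i]) := fun heq => by
  have hle := h.2 p <|
    (D.wordProd_append_singleton_eq_iff.mp heq.symm).trans (D.wordProd_append_singleton l i).symm
  rw [List.length_append, List.length_singleton] at hle
  lia

/-- Lengths of words with the same product agree modulo two, so multiplication by `s_i` cannot
preserve the length. -/
lemma IsReducedWord.exists_append_singleton (hl : D.IsReducedWord w l)
    (h : ¬ D.IsReduced (l ++ [i])) : ∃ p, D.IsReducedWord w (p ++ [i]) := by
  obtain ⟨p, hp, hlt⟩ :
      ∃ p, D.wordProd p = D.wordProd (l ++ [i]) ∧ p.length < (l ++ [i]).length := by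
    simpa [IsReducedWord] using h
  have hpw : D.wordProd (p ++ [i]) = w := by
    rw [wordProd_append_singleton_eq_iff, hp, wordProd_append_singleton, hl.1]
  have hparity := even_length_iff_of_wordProd_eq hp
  rw [List.length_append, List.length_singleton] at hlt hparity
  have hne : p.length ≠ l.length := fun heq => by
    rw [heq, Nat.even_add_one] at hparity
    exact iff_not_self hparity
  exact ⟨p, hl.of_length_le hpw (by rw [List.length_append, List.length_singleton]; lia)⟩

/-! ### Dihedral parabolic subgroups -/

lemma IsReducedWord.exists_append_parabolic (hl : D.IsReducedWord w l) (i j : I) :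
    ∃ p u, D.IsReducedWord w (p ++ u) ∧ (∀ x ∈ u, x = i ∨ x = j) ∧
      D.IsReduced (p ++ [i]) ∧ D.IsReduced (p ++ [j]) := by
  induction hn : l.length using Nat.strong_induction_on generalizing w l with
  | _ n ih =>
    by_cases h : D.IsReduced (l ++ [i]) ∧ D.IsReduced (l ++ [j])
    · exact ⟨l, [], by simpa using hl, by simp, h⟩
    obtain ⟨x, hx, hred⟩ : ∃ x, (x = i ∨ x = j) ∧ ¬ D.IsReduced (l ++ [x]) := by
      by_cases hi : D.IsReduced (l ++ [i])
      · exact ⟨j, Or.inr rfl, fun hj => h ⟨hi, hj⟩⟩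
      · exact ⟨i, Or.inl rfl, hi⟩
    obtain ⟨q, hq⟩ := hl.exists_append_singleton hred
    have hlen : q.length + 1 = l.length := by simpa using hq.length_eq_length hl
    obtain ⟨p, u, hpu, hu, hp⟩ := ih q.length (by lia) hq.isReduced.left rfl
    refine ⟨p, u ++ [x], ⟨?_, fun l' hl' => ?_⟩, ?_, hp⟩
    · rw [← List.append_assoc, wordProd_append, hpu.1, ← wordProd_append, hq.1]
    · calc (p ++ (u ++ [x])).length = (p ++ u).length + 1 := by simp; ring
        _ = (q ++ [x]).length := by rw [hpu.length_eq_length hq.isReduced.left]; simp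
        _ ≤ l'.length := hq.2 l' hl'
    · simpa [or_imp, forall_and] using ⟨hu, hx⟩

lemma IsReduced.eq_alternatingWord {u : List I} (hu : D.IsReduced u)
    (h : ∀ x ∈ u, x = i ∨ x = j) :
    u = alternatingWord i j u.length ∨ u = alternatingWord j i u.length := by
  induction u using List.reverseRecOn with
  | nil => simp [alternatingWord]
  | append_singleton u x ih =>
    have ih := ih hu.left fun y hy => h y (by simp [hy])
    have hx := h x (by simp)
    rcases u.eq_nil_or_concat with rfl | ⟨v, z, rfl⟩
    · rcases hx with rfl | rfl <;> simp [alternatingWord]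
    rw [List.concat_eq_append] at hu ih ⊢
    have hzx : z ≠ x := by
      rintro rfl
      exact hu.wordProd_ne (p := v) (by simp) rfl
    have eq_of_eq_alternatingWord {a b : I}
        (heq : v ++ [z] = alternatingWord a b (v ++ [z]).length) : z = b := by
      rw [List.length_append, List.length_singleton, alternatingWord_succ,
        List.concat_eq_append] at heq
      simpa using List.append_inj_right' heq rfl
    rw [List.length_append, List.length_singleton, alternatingWord_succ, alternatingWord_succ,
      List.concat_eq_append, List.concat_eq_append]
    rcases ih with ih | ih <;> have hz := eq_of_eq_alternatingWord ih
    · exact Or.inr (by rw [← ih, hx.resolve_right (hz ▸ hzx.symm)])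
    · exact Or.inl (by rw [← ih, hx.resolve_left (hz ▸ hzx.symm)])

variable (D) in
lemma wordProd_alternatingWord_simpleRoot (i j : I) (n : ℕ) :
    D.wordProd (alternatingWord i j n) (D.simpleRoot i) =
      (dihedralCoeff (-D.C i j) (-D.C j i) n).1 • D.simpleRoot i +
      (dihedralCoeff (-D.C i j) (-D.C j i) n).2 • D.simpleRoot j := by
  induction n with
  | zero => simp [alternatingWord, dihedralCoeff]
  | succ n ih =>
    rw [alternatingWord_succ', wordProd_cons, LinearEquiv.mul_apply, ih, map_add, map_smul,
      map_smul, dihedralCoeff]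
    split_ifs <;>
    · rw [simpleReflection_simpleRoot_self, simpleReflection_simpleRoot]
      module

lemma wordProd_alternatingWord_comm (hij : i ≠ j) :
    D.wordProd (alternatingWord i j (D.braidOrder i j)) =
      D.wordProd (alternatingWord j i (D.braidOrder i j)) := by
  ext1 x
  have hii := D.simpleCoroot_simpleRoot i i
  have hjj := D.simpleCoroot_simpleRoot j j
  have hCij := D.simpleCoroot_simpleRoot i j
  have hCji := D.simpleCoroot_simpleRoot j i
  rw [D.diag] at hii hjj
  rcases D.cartan_cases hij with h | h | h | h | h | h <;> obtain ⟨hC, hC'⟩ := h <;>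
    rw [hC] at hCij <;> rw [hC'] at hCji <;> simp only [hC, hC', braidOrder] <;>
    norm_num [alternatingWord, -zsmul_eq_mul, hii, hjj, hCij, hCji] <;> module

lemma IsReduced.le_braidOrder (hij : i ≠ j) {n : ℕ} (h : D.IsReduced (alternatingWord i j n)) :
    n ≤ D.braidOrder i j := by
  by_contra! hn
  obtain ⟨p, hp⟩ := exists_append_alternatingWord_eq i j (Nat.succ_le_of_lt hn)
  rw [← hp] at h
  have hsucc := h.right
  rw [Nat.succ_eq_add_one, alternatingWord_succ, List.concat_eq_append] at hsucc
  obtain ⟨m, hm⟩ := Nat.exists_eq_add_one.mpr (D.braidOrder_pos i j)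
  refine hsucc.wordProd_ne (p := alternatingWord j i m) ?_ ?_
  · simp only [length_alternatingWord]
    lia
  · rw [← wordProd_alternatingWord_comm hij, hm, alternatingWord_succ, List.concat_eq_append]

lemma IsReducedWord.exists_append_alternatingWord (hl : D.IsReducedWord w l) (hij : i ≠ j) :
    ∃ p n, D.IsReduced (p ++ [i]) ∧ D.IsReduced (p ++ [j]) ∧ n ≤ D.braidOrder i j ∧
      (D.IsReducedWord w (p ++ alternatingWord i j n) ∨
        D.IsReducedWord w (p ++ alternatingWord j i n)) := by
  obtain ⟨p, u, hpu, hu, hpi, hpj⟩ := hl.exists_append_parabolic i j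
  have hured : D.IsReduced u := hpu.isReduced.right
  refine ⟨p, u.length, hpi, hpj, ?_⟩
  rcases hured.eq_alternatingWord hu with heq | heq <;> rw [heq] at hured
  · exact ⟨hured.le_braidOrder hij, Or.inl (heq ▸ hpu)⟩
  · exact ⟨D.braidOrder_comm j i ▸ hured.le_braidOrder hij.symm, Or.inr (heq ▸ hpu)⟩

lemma IsReduced.exists_append_alternatingWord_lt (hl : D.IsReduced (l ++ [i])) (hne : l ≠ []) :
    ∃ j p n, i ≠ j ∧ 0 < n ∧ n < D.braidOrder i j ∧
      D.IsReducedWord (D.wordProd l) (p ++ alternatingWord i j n) ∧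
      D.IsReduced (p ++ [i]) ∧ D.IsReduced (p ++ [j]) := by
  obtain ⟨l, j, rfl⟩ := (List.eq_nil_or_concat' l).resolve_left hne
  have hij : i ≠ j := by
    rintro rfl
    exact hl.wordProd_ne (p := l) (by simp) rfl
  obtain ⟨p, n, hpi, hpj, hn, hw⟩ := hl.left.exists_append_alternatingWord hij
  have not_succ (k : ℕ) : ¬ D.IsReducedWord (D.wordProd (l ++ [j]))
      (p ++ alternatingWord j i (k + 1)) := fun h => by
    rw [alternatingWord_succ, List.concat_eq_append, ← List.append_assoc] at h
    refine hl.wordProd_ne (Nat.le_of_succ_le ?_) h.1.symm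
    rw [← h.length_eq_length hl.left]
    exact (List.length_append.trans (by simp)).ge
  have hn₀ : n ≠ 0 := by
    rintro rfl
    have hp : D.IsReducedWord (D.wordProd (l ++ [j])) p := by simpa [alternatingWord] using hw
    refine hpj.wordProd_ne ?_ hp.1
    rw [hp.length_eq_length hl.left, List.length_append]
    exact Nat.le_add_right _ _
  obtain ⟨k, rfl⟩ := Nat.exists_eq_succ_of_ne_zero hn₀
  have hw' := hw.resolve_right (not_succ k)
  refine ⟨j, p, k + 1, hij, k.succ_pos, lt_of_le_of_ne hn fun heq => not_succ k ?_, hw', hpi, hpj⟩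
  refine hw'.of_length_le ?_ (by simp)
  rw [← hw'.1, Nat.succ_eq_add_one, heq, wordProd_append, wordProd_append,
    wordProd_alternatingWord_comm hij]

lemma wordProd_append_alternatingWord_simpleRoot_nonneg (hij : i ≠ j) {n : ℕ}
    (hn : n < D.braidOrder i j) (hi : 0 ≤ D.wordProd l (D.simpleRoot i))
    (hj : 0 ≤ D.wordProd l (D.simpleRoot j)) :
    0 ≤ D.wordProd (l ++ alternatingWord i j n) (D.simpleRoot i) := by
  obtain ⟨hfst, hsnd⟩ := dihedralCoeff_nonneg hij hn
  rw [wordProd_append, LinearEquiv.mul_apply, wordProd_alternatingWord_simpleRoot, map_add,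
    map_smul, map_smul]
  exact add_nonneg (smul_nonneg hfst hi) (smul_nonneg hsnd hj)

lemma IsReduced.wordProd_simpleRoot_nonneg (hl : D.IsReduced (l ++ [i])) :
    0 ≤ D.wordProd l (D.simpleRoot i) := by
  induction hn : l.length using Nat.strong_induction_on generalizing l i with
  | _ n ih =>
    rcases eq_or_ne l [] with rfl | hne
    · exact Pi.single_nonneg.mpr zero_le_one
    obtain ⟨j, p, m, hij, hm₀, hm, hw, hpi, hpj⟩ := hl.exists_append_alternatingWord_lt hne
    have hlen : p.length + m = l.length := by simpa using hw.length_eq_length hl.left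
    rw [← hw.1]
    exact wordProd_append_alternatingWord_simpleRoot_nonneg hij hm
      (ih p.length (by lia) hpi rfl) (ih p.length (by lia) hpj rfl)

lemma IsReducedWord.apply_simpleRoot_nonpos (hl : D.IsReducedWord w (l ++ [i])) :
    w (D.simpleRoot i) ≤ 0 := by
  rw [← hl.1, wordProd_append_singleton, LinearEquiv.mul_apply, simpleReflection_simpleRoot_self,
    map_neg, neg_nonpos]
  exact hl.isReduced.wordProd_simpleRoot_nonneg

/-- A shorter alternating word would send `α_i` or `α_j` to a nonnegative vector, contradicting that
both are right descents. -/
lemma IsReducedWord.exists_append_alternatingWord_braidOrder (hij : i ≠ j)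
    (hi : D.IsReducedWord w (l ++ [i])) (hj : D.IsReducedWord w (l' ++ [j])) :
    ∃ p, D.IsReducedWord w (p ++ alternatingWord i j (D.braidOrder i j)) ∧
      D.IsReducedWord w (p ++ alternatingWord j i (D.braidOrder i j)) := by
  obtain ⟨p, n, hpi, hpj, hn, hw⟩ := hi.exists_append_alternatingWord hij
  have hi₀ := hpi.wordProd_simpleRoot_nonneg
  have hj₀ := hpj.wordProd_simpleRoot_nonneg
  obtain rfl : n = D.braidOrder i j := by
    refine hn.eq_of_not_lt fun hlt => ?_
    rcases hw with hw | hw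
    · refine D.map_simpleRoot_ne_zero w i (le_antisymm hi.apply_simpleRoot_nonpos ?_)
      rw [← hw.1]
      exact wordProd_append_alternatingWord_simpleRoot_nonneg hij hlt hi₀ hj₀
    · refine D.map_simpleRoot_ne_zero w j (le_antisymm hj.apply_simpleRoot_nonpos ?_)
      rw [← hw.1]
      exact wordProd_append_alternatingWord_simpleRoot_nonneg hij.symm
        (D.braidOrder_comm i j ▸ hlt) hj₀ hi₀
  have hcomm : D.wordProd (p ++ alternatingWord i j (D.braidOrder i j)) =
      D.wordProd (p ++ alternatingWord j i (D.braidOrder i j)) := by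
    rw [wordProd_append, wordProd_append, wordProd_alternatingWord_comm hij]
  rcases hw with hw | hw
  · exact ⟨p, hw, hw.of_length_le (hcomm.symm.trans hw.1) (by simp)⟩
  · exact ⟨p, hw.of_length_le (hcomm.trans hw.1) (by simp), hw⟩

variable (D) in
/-- The family `g` satisfies the braid relations. -/
def BraidRelations {G : Type*} [Monoid G] (g : I → G) : Prop :=
  ∀ i j, i ≠ j → ((alternatingWord i j (D.braidOrder i j)).map g).prod =
    ((alternatingWord j i (D.braidOrder i j)).map g).prod

/-- Matsumoto's theorem. Reduced words with distinct last letters are compared through reduced words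
that end in the two sides of a braid relation. -/
theorem BraidRelations.prod_map_eq {G : Type*} [Monoid G] {g : I → G} (hg : D.BraidRelations g)
    (hl : D.IsReducedWord w l) (hl' : D.IsReducedWord w l') : (l.map g).prod = (l'.map g).prod := by
  induction hn : l.length using Nat.strong_induction_on generalizing w l l' with
  | _ n ih =>
    have prod_eq_of_same_end {k k' : List I} {i : I} (hk : D.IsReducedWord w (k ++ [i]))
        (hk' : D.IsReducedWord w (k' ++ [i])) :
        ((k ++ [i]).map g).prod = ((k' ++ [i]).map g).prod := by
      have hlen : k.length + 1 = l.length := by simpa using hk.length_eq_length hl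
      have hw : D.wordProd k = D.wordProd k' := by simpa using hk.1.trans hk'.1.symm
      rw [List.map_append, List.prod_append, List.map_append, List.prod_append,
        ih k.length (by lia) hk.isReduced.left (by rw [hw]; exact hk'.isReduced.left) rfl]
    rcases List.eq_nil_or_concat' l with rfl | ⟨l, i, rfl⟩
    · rw [List.eq_nil_of_length_eq_zero (hl'.length_eq_length hl)]
    rcases List.eq_nil_or_concat' l' with rfl | ⟨l', j, rfl⟩
    · simpa using hl.length_eq_length hl'
    rcases eq_or_ne i j with rfl | hij
    · exact prod_eq_of_same_end hl hl'
    obtain ⟨p, hpi, hpj⟩ := hl.exists_append_alternatingWord_braidOrder hij hl'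
    have hbraid : ((p ++ alternatingWord j i (D.braidOrder i j)).map g).prod =
        ((p ++ alternatingWord i j (D.braidOrder i j)).map g).prod := by
      rw [List.map_append, List.prod_append, List.map_append, List.prod_append, hg i j hij]
    obtain ⟨m, hm⟩ := Nat.exists_eq_add_one.mpr (D.braidOrder_pos i j)
    simp only [hm, alternatingWord_succ, List.concat_eq_append, ← List.append_assoc]
      at hpi hpj hbraid
    rw [prod_eq_of_same_end hl hpj, hbraid, prod_eq_of_same_end hpi hl']

variable (D) in
lemma height_simpleRoot (i : I) : height (D.simpleRoot i) = 1 := by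
  simp [height_apply, simpleRoot]

variable (D) in
lemma exists_eq_simpleRoot_of_height_le_one {x : I → ℤ} (hx : 0 ≤ x) (hne : x ≠ 0)
    (hht : height x ≤ 1) : ∃ i, x = D.simpleRoot i := by
  obtain ⟨i, hi⟩ := Function.ne_iff.mp hne
  have hle : D.simpleRoot i ≤ x := fun j => by
    rcases eq_or_ne j i with rfl | hj
    · simpa [simpleRoot] using Order.one_le_iff_pos.mpr (lt_of_le_of_ne (hx j) (Ne.symm hi))
    · simpa [simpleRoot, hj] using hx j
  refine ⟨i, by_contra fun hdiff => ?_⟩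
  have := one_le_height (sub_nonneg.mpr hle) (sub_ne_zero.mpr hdiff)
  rw [map_sub, height_simpleRoot] at this
  lia

/-- As heights of roots are at least one, the dihedral right factor of the word must itself send
`α_i` to a simple root, and this determines the factor. -/
theorem BraidRelations.prod_map_smul_eq {G X : Type*} [Monoid G] [MulAction G X]
    {g : I → G} (hg : D.BraidRelations g) (y : I → X)
    (hy : ∀ i j, i ≠ j → ((alternatingWord i j (D.braidOrder i j - 1)).map g).prod • y i =
      y (if D.braidOrder i j = 3 then j else i))
    (hl : D.IsReduced (l ++ [i])) (h : D.wordProd l (D.simpleRoot i) = D.simpleRoot j) :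
    (l.map g).prod • y i = y j := by
  induction hn : l.length using Nat.strong_induction_on generalizing l i with
  | _ n ih =>
    rcases eq_or_ne l [] with rfl | hne
    · obtain rfl : i = j := by
        by_contra hij
        simpa [simpleRoot, Ne.symm hij] using congrFun h j
      exact one_smul G _
    obtain ⟨k, p, m, hik, hm₀, hm, hw, hpi, hpk⟩ := hl.exists_append_alternatingWord_lt hne
    obtain ⟨hfst, hsnd⟩ := dihedralCoeff_nonneg hik hm
    have hroot := h
    rw [← hw.1, wordProd_append, LinearEquiv.mul_apply, wordProd_alternatingWord_simpleRoot,
      map_add, map_smul, map_smul] at hroot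
    have hzero : (dihedralCoeff (-D.C i k) (-D.C k i) m).1 = 0 ∨
        (dihedralCoeff (-D.C i k) (-D.C k i) m).2 = 0 := by
      by_contra! hpos
      have hht := congrArg height hroot
      rw [map_add, map_smul, map_smul, height_simpleRoot, smul_eq_mul, smul_eq_mul] at hht
      have hi := one_le_height hpi.wordProd_simpleRoot_nonneg (D.map_simpleRoot_ne_zero _ i)
      have hk := one_le_height hpk.wordProd_simpleRoot_nonneg (D.map_simpleRoot_ne_zero _ k)
      have := le_mul_of_one_le_right hfst hi
      have := le_mul_of_one_le_right hsnd hk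
      lia
    obtain ⟨rfl, hcoeff⟩ := dihedralCoeff_of_eq_zero hik hm hm₀ hzero
    have hlen : p.length < n := by
      have : p.length + (D.braidOrder i k - 1) = l.length := by
        simpa using hw.length_eq_length hl.left
      lia
    rw [hg.prod_map_eq hl.left hw, List.map_append, List.prod_append, mul_smul,
      hy i k hik]
    rw [hcoeff] at hroot
    split_ifs with hthree
    · exact ih p.length hlen hpk (by simpa [hthree] using hroot) rfl
    · exact ih p.length hlen hpi (by simpa [hthree] using hroot) rfl

/-! ### The longest element -/

lemma IsLongest.not_isReduced (h : D.IsLongest w) (hl : D.IsReducedWord w l) (i : I) :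
    ¬ D.IsReduced (l ++ [i]) := fun hred => by
  have := h.2 _ (D.wordProd_mem_weylGroup (l ++ [i]))
  rw [hred.length_eq, hl.length_eq, List.length_append, List.length_singleton] at this
  lia

lemma IsLongest.exists_isReducedWord_append_singleton (h : D.IsLongest w) (i : I) :
    ∃ p, D.IsReducedWord w (p ++ [i]) := by
  obtain ⟨l, hl⟩ := D.exists_isReducedWord h.1
  exact hl.exists_append_singleton (h.not_isReduced hl i)

lemma IsLongest.inv (h : D.IsLongest w) : D.IsLongest w⁻¹ := by
  obtain ⟨l, hl⟩ := D.exists_isReducedWord h.1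
  refine ⟨inv_mem h.1, fun w' hw' => (h.2 w' hw').trans_eq ?_⟩
  rw [hl.length_eq, hl.reverse.length_eq, List.length_reverse]

lemma IsLongest.neg_apply_simpleRoot_nonneg (h : D.IsLongest w) (i : I) :
    0 ≤ -w (D.simpleRoot i) := by
  obtain ⟨p, hp⟩ := h.exists_isReducedWord_append_singleton i
  exact neg_nonneg.mpr hp.apply_simpleRoot_nonpos

/-- As `-w⁻¹` sends simple roots to nonzero nonnegative vectors, it does not decrease heights, so
`-w α_i` is a simple root because its image `α_i` has height one. -/
lemma IsLongest.exists_apply_simpleRoot_eq_neg (h : D.IsLongest w) (i : I) :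
    ∃ j, w (D.simpleRoot i) = -D.simpleRoot j := by
  have one_le (k : I) : 1 ≤ height (-w⁻¹ (D.simpleRoot k)) :=
    one_le_height (h.inv.neg_apply_simpleRoot_nonneg k)
      (neg_ne_zero.mpr (D.map_simpleRoot_ne_zero _ k))
  set β : I → ℤ := -w (D.simpleRoot i) with hβ
  have hβ₀ : 0 ≤ β := h.neg_apply_simpleRoot_nonneg i
  have hinv : D.simpleRoot i = ∑ k, β k • -w⁻¹ (D.simpleRoot k) :=
    calc D.simpleRoot i = -w⁻¹ β := by
          rw [hβ, map_neg, neg_neg]; exact (w.symm_apply_apply _).symm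
      _ = -w⁻¹ (∑ k, β k • D.simpleRoot k) := congrArg (fun x => -w⁻¹ x) (pi_eq_sum_univ' β)
      _ = ∑ k, β k • -w⁻¹ (D.simpleRoot k) := by
          simp only [map_sum, map_smul, smul_neg, Finset.sum_neg_distrib]
  have hheight : height β ≤ 1 :=
    calc height β = ∑ k, β k := height_apply β
      _ ≤ ∑ k, β k * height (-w⁻¹ (D.simpleRoot k)) :=
          Finset.sum_le_sum fun k _ => le_mul_of_one_le_right (hβ₀ k) (one_le k)
      _ = height (D.simpleRoot i) := by simp only [hinv, map_sum, map_smul, smul_eq_mul]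
      _ = 1 := D.height_simpleRoot i
  obtain ⟨j, hj⟩ := D.exists_eq_simpleRoot_of_height_le_one hβ₀
    (neg_ne_zero.mpr (D.map_simpleRoot_ne_zero w i)) hheight
  exact ⟨j, by rw [← hj, hβ, neg_neg]⟩

end SimpleCartanDatum

namespace QuantumAdjoint

open Finset.HasAntidiagonal (antidiagonal mem_antidiagonal)

section Scalars

variable {K : Type*} [Field K]

/-- A generic quantum parameter: nonzero and not a root of unity. -/
structure Generic (q : K) : Prop where
  ne_zero : q ≠ 0
  pow_ne_one : ∀ n : ℕ, 0 < n → q ^ n ≠ 1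

/-- The quantum integer `[n] = (q ^ n - q ^ (-n)) / (q - q⁻¹)`. -/
def qNum (q : K) (n : ℕ) : K := (q ^ n - (q ^ n)⁻¹) / (q - q⁻¹)

/-- The quantum factorial `[n]!`. -/
def qFac (q : K) (n : ℕ) : K := ∏ k ∈ Finset.range n, qNum q (k + 1)

@[simp] lemma qNum_zero (q : K) : qNum q 0 = 0 := by simp [qNum]

@[simp] lemma qFac_zero (q : K) : qFac q 0 = 1 := by simp [qFac]

lemma qFac_succ (q : K) (n : ℕ) : qFac q (n + 1) = qFac q n * qNum q (n + 1) :=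
  Finset.prod_range_succ _ _

lemma qNum_add (q : K) (s t : ℕ) :
    qNum q (s + t) = (q ^ s)⁻¹ * qNum q t + q ^ t * qNum q s := by
  rcases eq_or_ne q 0 with rfl | hq
  · simp [qNum]
  simp only [qNum, mul_div, ← add_div]
  congr 1
  field_simp
  ring

/-- Splitting `[n + 1]` by `qNum_add` and shifting indices is the inductive step of every
`q`-binomial expansion. -/
lemma qNum_smul_sum_antidiagonal {M : Type*} [AddCommGroup M] [Module K M] (q : K)
    (F : ℕ → ℕ → M) (n : ℕ) :
    qNum q (n + 1) • ∑ p ∈ antidiagonal (n + 1), F p.1 p.2 =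
      ∑ p ∈ antidiagonal n, (((q ^ p.1)⁻¹ * qNum q (p.2 + 1)) • F p.1 (p.2 + 1) +
        (q ^ p.2 * qNum q (p.1 + 1)) • F (p.1 + 1) p.2) := by
  have split : ∀ p ∈ antidiagonal (n + 1), qNum q (n + 1) • F p.1 p.2 =
      ((q ^ p.1)⁻¹ * qNum q p.2) • F p.1 p.2 + (q ^ p.2 * qNum q p.1) • F p.1 p.2 := fun p hp => by
    rw [← mem_antidiagonal.mp hp, qNum_add, add_smul]
  rw [Finset.smul_sum, Finset.sum_congr rfl split, Finset.sum_add_distrib,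
    Finset.Nat.sum_antidiagonal_succ', Finset.Nat.sum_antidiagonal_succ, Finset.sum_add_distrib]
  simp only [qNum_zero, mul_zero, zero_smul, zero_add]

variable {q : K} (hq : Generic q)
include hq

lemma Generic.pow_sub_inv_ne_zero {n : ℕ} (hn : 0 < n) : q ^ n - (q ^ n)⁻¹ ≠ 0 := fun h =>
  hq.pow_ne_one (n + n) (by lia) <| by
    rw [pow_add, mul_eq_one_iff_eq_inv₀ (pow_ne_zero n hq.ne_zero), ← sub_eq_zero, h]

lemma Generic.sub_inv_ne_zero : q - q⁻¹ ≠ 0 := by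
  simpa using hq.pow_sub_inv_ne_zero one_pos

lemma Generic.qNum_ne_zero {n : ℕ} (hn : 0 < n) : qNum q n ≠ 0 :=
  div_ne_zero (hq.pow_sub_inv_ne_zero hn) hq.sub_inv_ne_zero

lemma Generic.qFac_ne_zero (n : ℕ) : qFac q n ≠ 0 :=
  Finset.prod_ne_zero_iff.mpr fun _ _ => hq.qNum_ne_zero (Nat.succ_pos _)

end Scalars

/-! ### Iterated `q`-commutators -/

variable {K B : Type*} [Field K] [Ring B] [Algebra K B]

section Adjoint

/-- The iterated `q`-commutators with `f`: writing `x_s = qad q r f s x`, one has `x_0 = x` and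
`x_{s+1} = x_s f - r q^{2s} f x_s`. -/
def qad (q r : K) (f : B) : ℕ → Module.End K B
  | 0 => LinearMap.id
  | s + 1 => (LinearMap.mulRight K f - (r * q ^ (2 * s)) • LinearMap.mulLeft K f) ∘ₗ qad q r f s

/-- The mirror image of `qad`: writing `x_s = rqad q r f s x`, one has `x_0 = x` and
`x_{s+1} = f x_s - r q^{2s} x_s f`. -/
def rqad (q r : K) (f : B) : ℕ → Module.End K B
  | 0 => LinearMap.id
  | s + 1 => (LinearMap.mulLeft K f - (r * q ^ (2 * s)) • LinearMap.mulRight K f) ∘ₗ rqad q r f s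

variable (q r : K) (f x : B)

@[simp] lemma qad_zero : qad q r f 0 x = x := rfl

@[simp] lemma rqad_zero : rqad q r f 0 x = x := rfl

lemma qad_succ (s : ℕ) :
    qad q r f (s + 1) x = qad q r f s x * f - (r * q ^ (2 * s)) • (f * qad q r f s x) := rfl

lemma rqad_succ (s : ℕ) :
    rqad q r f (s + 1) x = f * rqad q r f s x - (r * q ^ (2 * s)) • (rqad q r f s x * f) := rfl

lemma qad_smul_left (c : K) (s : ℕ) : qad q r (c • f) s x = c ^ s • qad q r f s x := by
  induction s with
  | zero => simp
  | succ s ih =>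
    simp only [qad_succ, ih, smul_mul_assoc, mul_smul_comm, pow_succ]
    module

lemma qad_add_apply (s t : ℕ) :
    qad q r f (s + t) x = qad q (r * q ^ (2 * s)) f t (qad q r f s x) := by
  induction t with
  | zero => rfl
  | succ t ih => rw [← add_assoc, qad_succ, ih, qad_succ, mul_assoc, ← pow_add, mul_add]

variable {q r f x} in
lemma qad_eq_zero_of_le {n m : ℕ} (h : qad q r f n x = 0) (hnm : n ≤ m) : qad q r f m x = 0 := by
  obtain ⟨t, rfl⟩ := Nat.exists_eq_add_of_le hnm
  rw [qad_add_apply, h, map_zero]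

lemma map_qad {C F : Type*} [Ring C] [Algebra K C] [FunLike F B C] [AlgHomClass F K B C] (φ : F)
    (s : ℕ) : φ (qad q r f s x) = qad q r (φ f) s (φ x) := by
  induction s with
  | zero => rfl
  | succ s ih => simp [qad_succ, ih]

lemma map_rqad {C F : Type*} [Ring C] [Algebra K C] [FunLike F B C] [AlgHomClass F K B C] (φ : F)
    (s : ℕ) : φ (rqad q r f s x) = rqad q r (φ f) s (φ x) := by
  induction s with
  | zero => rfl
  | succ s ih => simp [rqad_succ, ih]

lemma op_rqad (s : ℕ) :
    MulOpposite.op (rqad q r f s x) = qad q r (MulOpposite.op f) s (MulOpposite.op x) := by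
  induction s with
  | zero => rfl
  | succ s ih => simp [rqad_succ, qad_succ, ih]

lemma op_qad (s : ℕ) :
    MulOpposite.op (qad q r f s x) = rqad q r (MulOpposite.op f) s (MulOpposite.op x) := by
  induction s with
  | zero => rfl
  | succ s ih => simp [rqad_succ, qad_succ, ih]

/-- The divided power `f^{(k)} = f^k / [k]!`. -/
def dpow (k : ℕ) : B := (qFac q k)⁻¹ • f ^ k

@[simp] lemma dpow_zero : dpow q f 0 = 1 := by simp [dpow]

/-- The divided iterated `q`-commutator `qad q r f s / [s]!`. -/
def qadDiv (q r : K) (f : B) (s : ℕ) : Module.End K B := (qFac q s)⁻¹ • qad q r f s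

lemma qadDiv_apply (s : ℕ) : qadDiv q r f s x = (qFac q s)⁻¹ • qad q r f s x := rfl

@[simp] lemma qadDiv_zero : qadDiv q r f 0 x = x := by simp [qadDiv_apply]

variable {q} (hq : Generic q)
include hq

lemma Generic.qNum_smul_dpow_succ (k : ℕ) : qNum q (k + 1) • dpow q f (k + 1) = dpow q f k * f := by
  rw [dpow, dpow, qFac_succ, mul_inv_rev, mul_smul, smul_inv_smul₀ (hq.qNum_ne_zero k.succ_pos),
    smul_mul_assoc, pow_succ]

lemma Generic.qNum_smul_dpow_succ' (k : ℕ) :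
    qNum q (k + 1) • dpow q f (k + 1) = f * dpow q f k := by
  rw [hq.qNum_smul_dpow_succ, dpow, mul_smul_comm, smul_mul_assoc, pow_mul_comm']

lemma Generic.qNum_smul_qadDiv_succ (s : ℕ) : qNum q (s + 1) • qadDiv q r f (s + 1) x =
    qadDiv q r f s x * f - (r * q ^ (2 * s)) • (f * qadDiv q r f s x) := by
  rw [qadDiv_apply, qadDiv_apply, qFac_succ, mul_inv_rev, mul_smul,
    smul_inv_smul₀ (hq.qNum_ne_zero s.succ_pos), qad_succ, smul_sub, smul_mul_assoc,
    mul_smul_comm, smul_comm]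

lemma Generic.qadDiv_eq_sum (s : ℕ) : qadDiv q r f s x = ∑ p ∈ antidiagonal s,
    (-(r * q⁻¹ * q ^ s)) ^ p.1 • (dpow q f p.1 * x * dpow q f p.2) := by
  induction s with
  | zero => simp
  | succ n ih =>
    refine smul_right_injective B (hq.qNum_ne_zero n.succ_pos) ?_
    simp only [hq.qNum_smul_qadDiv_succ, ih, qNum_smul_sum_antidiagonal q fun k l =>
      (-(r * q⁻¹ * q ^ (n + 1))) ^ k • (dpow q f k * x * dpow q f l)]
    rw [Finset.sum_mul, Finset.mul_sum, Finset.smul_sum, ← Finset.sum_sub_distrib]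
    refine Finset.sum_congr rfl fun ⟨k, l⟩ hkl => ?_
    obtain rfl : k + l = n := mem_antidiagonal.mp hkl
    have hl : qNum q (l + 1) • (dpow q f k * x * dpow q f (l + 1)) =
        dpow q f k * x * dpow q f l * f := by
      rw [← mul_smul_comm, hq.qNum_smul_dpow_succ, ← mul_assoc]
    have hk : qNum q (k + 1) • (dpow q f (k + 1) * x * dpow q f l) =
        f * (dpow q f k * x * dpow q f l) := by
      rw [← smul_mul_assoc, ← smul_mul_assoc, hq.qNum_smul_dpow_succ', mul_assoc, mul_assoc,
        mul_assoc]
    have hcl : (q ^ k)⁻¹ * (-(r * q⁻¹ * q ^ (k + l + 1))) ^ k =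
        (-(r * q⁻¹ * q ^ (k + l))) ^ k := by
      rw [inv_mul_eq_iff_eq_mul₀ (pow_ne_zero k hq.ne_zero), ← mul_pow]
      congr 1
      ring
    have hck : q ^ l * (-(r * q⁻¹ * q ^ (k + l + 1))) ^ (k + 1) =
        -(r * q ^ (2 * (k + l)) * (-(r * q⁻¹ * q ^ (k + l))) ^ k) := by
      rw [pow_succ _ k, ← hcl]
      have := hq.ne_zero
      field_simp
      ring
    simp only [smul_mul_assoc, mul_smul_comm]
    rw [← hl, ← hk]
    match_scalars
    · linear_combination -qNum q (l + 1) * hcl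
    · linear_combination -qNum q (k + 1) * hck

lemma Generic.rqad_eq_sum (s : ℕ) : (qFac q s)⁻¹ • rqad q r f s x = ∑ p ∈ antidiagonal s,
    (-(r * q⁻¹ * q ^ s)) ^ p.1 • (dpow q f p.2 * x * dpow q f p.1) := by
  apply MulOpposite.op_injective
  have op_dpow (k : ℕ) : MulOpposite.op (dpow q f k) = dpow q (MulOpposite.op f) k := rfl
  rw [MulOpposite.op_smul, op_rqad, ← qadDiv_apply, hq.qadDiv_eq_sum, Finset.op_sum]
  simp only [MulOpposite.op_smul, MulOpposite.op_mul, op_dpow, mul_assoc]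

omit [Ring B] [Algebra K B] in
lemma Generic.neg_mul_inv_mul_pow_succ {r : K} {a : ℕ} (hr : r * q ^ a = 1) :
    -(r * q⁻¹ * q ^ (a + 1)) = -1 := by
  rw [pow_succ, mul_mul_mul_comm, hr, inv_mul_cancel₀ hq.ne_zero, one_mul]

/-- At the exponent of the quantum Serre relation both mirror images are the same alternating sum
up to sign. -/
lemma Generic.qad_eq_zero_iff {a : ℕ} (hr : r * q ^ a = 1) :
    qad q r f (a + 1) x = 0 ↔ rqad q r f (a + 1) x = 0 := by
  have hfac := inv_ne_zero (hq.qFac_ne_zero (a + 1))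
  have hsign : qadDiv q r f (a + 1) x =
      (-1 : K) ^ (a + 1) • (qFac q (a + 1))⁻¹ • rqad q r f (a + 1) x := by
    rw [hq.qadDiv_eq_sum, hq.rqad_eq_sum, hq.neg_mul_inv_mul_pow_succ hr,
      ← Finset.Nat.sum_antidiagonal_swap, Finset.smul_sum]
    refine Finset.sum_congr rfl fun p hp => ?_
    rw [← mem_antidiagonal.mp hp, smul_smul, Prod.fst_swap, Prod.snd_swap, pow_add,
      mul_right_comm, ← mul_pow, neg_one_mul, neg_neg, one_pow, one_mul]
  rw [← smul_eq_zero_iff_right hfac, ← qadDiv_apply, hsign,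
    smul_eq_zero_iff_right (pow_ne_zero _ (neg_ne_zero.mpr one_ne_zero)),
    smul_eq_zero_iff_right hfac]

lemma Generic.qadDiv_mul (ρ : K) (y : B) (N : ℕ) : qadDiv q (r * ρ) f N (x * y) =
    ∑ p ∈ antidiagonal N,
      (ρ ^ p.1 * q ^ (p.1 * p.2)) • (qadDiv q r f p.1 x * qadDiv q ρ f p.2 y) := by
  induction N with
  | zero => simp
  | succ N ih =>
    refine smul_right_injective B (hq.qNum_ne_zero N.succ_pos) ?_
    simp only [hq.qNum_smul_qadDiv_succ, ih, qNum_smul_sum_antidiagonal q fun s t =>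
      (ρ ^ s * q ^ (s * t)) • (qadDiv q r f s x * qadDiv q ρ f t y)]
    rw [Finset.sum_mul, Finset.mul_sum, Finset.smul_sum, ← Finset.sum_sub_distrib]
    refine Finset.sum_congr rfl fun ⟨s, t⟩ hst => ?_
    obtain rfl : s + t = N := mem_antidiagonal.mp hst
    have move_right : qadDiv q r f s x * qadDiv q ρ f t y * f =
        qNum q (t + 1) • (qadDiv q r f s x * qadDiv q ρ f (t + 1) y) + (ρ * q ^ (2 * t)) •
          (qNum q (s + 1) • (qadDiv q r f (s + 1) x * qadDiv q ρ f t y) +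
            (r * q ^ (2 * s)) • (f * (qadDiv q r f s x * qadDiv q ρ f t y))) := by
      rw [← mul_smul_comm, ← smul_mul_assoc (qNum q (s + 1)), hq.qNum_smul_qadDiv_succ,
        hq.qNum_smul_qadDiv_succ]
      simp only [mul_sub, sub_mul, mul_smul_comm, smul_mul_assoc, mul_assoc]
      module
    simp only [smul_mul_assoc, mul_smul_comm, move_right]
    have := hq.ne_zero
    match_scalars <;> field_simp <;> ring

end Adjoint

/-! ### Top divided powers -/

section Top

/-- `x` is a lowest weight vector of an `(n+1)`-dimensional module for the adjoint action of `f`,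
and `X` is its image under the top divided power, normalized by the scalar `η`. -/
def IsTopPower (q η : K) (f : B) (n : ℕ) (x X : B) : Prop :=
  qadDiv q (q⁻¹ ^ n) f n x = η ^ n • X ∧ qad q (q⁻¹ ^ n) f (n + 1) x = 0

variable {q η : K} {f x X y Y : B} {n m : ℕ}

namespace IsTopPower

lemma one : IsTopPower q η f 0 1 1 := by simp [IsTopPower, qad_succ]

lemma zero : IsTopPower q η f n (0 : B) 0 := by simp [IsTopPower]

lemma smul (h : IsTopPower q η f n x X) (c : K) : IsTopPower q η f n (c • x) (c • X) := by
  simp only [IsTopPower, map_smul, h.1, h.2, smul_comm c, smul_zero, and_self]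

lemma sub (hx : IsTopPower q η f n x X) (hy : IsTopPower q η f n y Y) :
    IsTopPower q η f n (x - y) (X - Y) := by
  simp only [IsTopPower, map_sub, hx.1, hx.2, hy.1, hy.2, smul_sub, sub_zero, and_self]

lemma sum {ι : Type*} (s : Finset ι) {x X : ι → B}
    (h : ∀ i ∈ s, IsTopPower q η f n (x i) (X i)) :
    IsTopPower q η f n (∑ i ∈ s, x i) (∑ i ∈ s, X i) := by
  simp only [IsTopPower, map_sum, Finset.smul_sum]
  exact ⟨Finset.sum_congr rfl fun i hi => (h i hi).1, Finset.sum_eq_zero fun i hi => (h i hi).2⟩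

lemma qadDiv_eq_zero (h : IsTopPower q η f n x X) {s : ℕ} (hs : n < s) :
    qadDiv q (q⁻¹ ^ n) f s x = 0 := by
  rw [qadDiv_apply, qad_eq_zero_of_le h.2 hs, smul_zero]

variable (hq : Generic q)
include hq

lemma mul (hx : IsTopPower q η f n x X) (hy : IsTopPower q η f m y Y) :
    IsTopPower q η f (n + m) (x * y) (X * Y) := by
  have summand_eq_zero {p : ℕ × ℕ} (hp : n < p.1 ∨ m < p.2) :
      ((q⁻¹ ^ m) ^ p.1 * q ^ (p.1 * p.2)) •
        (qadDiv q (q⁻¹ ^ n) f p.1 x * qadDiv q (q⁻¹ ^ m) f p.2 y) = 0 := by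
    rcases hp with hp | hp
    · rw [hx.qadDiv_eq_zero hp, zero_mul, smul_zero]
    · rw [hy.qadDiv_eq_zero hp, mul_zero, smul_zero]
  constructor
  · rw [pow_add, hq.qadDiv_mul, Finset.sum_eq_single (n, m), hx.1, hy.1, mul_comm n m, pow_mul,
      ← mul_pow, inv_pow, inv_mul_cancel₀ (pow_ne_zero _ hq.ne_zero), one_pow, one_smul,
      smul_mul_smul_comm, pow_add]
    · intro p hp hne
      rw [mem_antidiagonal] at hp
      refine summand_eq_zero ?_
      contrapose! hne
      exact Prod.ext (by lia) (by lia)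
    · exact fun hnm => (hnm (mem_antidiagonal.mpr rfl)).elim
  · have vanish : qadDiv q (q⁻¹ ^ n * q⁻¹ ^ m) f (n + m + 1) (x * y) = 0 := by
      rw [hq.qadDiv_mul]
      refine Finset.sum_eq_zero fun p hp => summand_eq_zero ?_
      rw [mem_antidiagonal] at hp
      lia
    rw [pow_add]
    exact (smul_eq_zero.mp vanish).resolve_left (inv_ne_zero (hq.qFac_ne_zero _))

lemma pow (h : IsTopPower q η f n x X) (k : ℕ) : IsTopPower q η f (k * n) (x ^ k) (X ^ k) := by
  induction k with
  | zero => simpa using one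
  | succ k ih =>
    rw [pow_succ, pow_succ, Nat.succ_mul]
    exact ih.mul hq h

lemma qad (hx : IsTopPower q η f n x X) (hy : IsTopPower q η f m y Y) (p r : K) (s : ℕ) :
    IsTopPower q η f (m + s * n) (qad p r x s y) (qad p r X s Y) := by
  induction s with
  | zero => simpa using hy
  | succ s ih =>
    rw [Nat.succ_mul, ← add_assoc, qad_succ, qad_succ]
    refine (ih.mul hq hx).sub ?_
    rw [add_comm (m + s * n)]
    exact (hx.mul hq ih).smul _

omit hq in
lemma unique (hη : η ≠ 0) (h : IsTopPower q η f n x X) (h' : IsTopPower q η f n x Y) : X = Y :=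
  smul_right_injective B (pow_ne_zero n hη) (h.1.symm.trans h'.1)

end IsTopPower

end Top

/-! ### Commuting iterated commutators past each other -/

section Boson

/-- The structure constant by which `e` lowers `qad q r f (s + 1) x` to `qad q r f s x`. -/
def lowerCoeff (q r : K) (s : ℕ) : K := (1 - q ^ (2 * (s + 1))) * (1 - r ^ 2 * q ^ (2 * s))

/-- The structure constant by which `s` iterated commutators with `e` lower `qad q r f a x` to
`qad q r f (a - s) x` if `r * q ^ a = 1`. -/
def lowerProd (q r : K) (a s : ℕ) : K :=
  ∏ u ∈ Finset.range s, (-(r * q ^ (2 * u)) * lowerCoeff q r (a - 1 - u))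

lemma lowerProd_succ (q r : K) (a s : ℕ) : lowerProd q r a (s + 1) =
    lowerProd q r a s * (-(r * q ^ (2 * s)) * lowerCoeff q r (a - 1 - s)) :=
  Finset.prod_range_succ _ _

variable {q r r' κ μ ν : K} {e f g x y : B}

lemma qad_mul_of_comm (hx : x * g = ν • (g * x)) (hf : f * g = μ • (g * f)) (s : ℕ) :
    qad q r f s x * g = (ν * μ ^ s) • (g * qad q r f s x) := by
  induction s with
  | zero => simp [hx]
  | succ s ih =>
    rw [qad_succ]
    generalize qad q r f s x = v at *
    have hvf : v * f * g = (ν * μ ^ s * μ) • (g * (v * f)) := by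
      rw [mul_assoc, hf, mul_smul_comm, ← mul_assoc, ih, smul_mul_assoc, mul_assoc, smul_smul,
        mul_comm μ]
    have hfv : f * v * g = (ν * μ ^ s * μ) • (g * (f * v)) := by
      rw [mul_assoc, ih, mul_smul_comm, ← mul_assoc, hf, smul_mul_assoc, mul_assoc, smul_smul]
    rw [sub_mul, smul_mul_assoc, hvf, hfv, mul_sub, mul_smul_comm, smul_sub, smul_comm, pow_succ,
      mul_assoc ν]

lemma mul_qad_of_comm (hx : g * x = ν • (x * g)) (hf : g * f = μ • (f * g)) (s : ℕ) :
    g * qad q r f s x = (ν * μ ^ s) • (qad q r f s x * g) := by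
  induction s with
  | zero => simp [hx]
  | succ s ih =>
    rw [qad_succ]
    generalize qad q r f s x = v at *
    have hvf : g * (v * f) = (ν * μ ^ s * μ) • (v * f * g) := by
      rw [← mul_assoc, ih, smul_mul_assoc, mul_assoc, hf, mul_smul_comm, ← mul_assoc, smul_smul]
    have hfv : g * (f * v) = (ν * μ ^ s * μ) • (f * v * g) := by
      rw [← mul_assoc, hf, smul_mul_assoc, mul_assoc, ih, mul_smul_comm, ← mul_assoc, smul_smul,
        mul_comm μ]
    rw [mul_sub, mul_smul_comm, hvf, hfv, sub_mul, smul_mul_assoc, smul_sub, smul_comm, pow_succ,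
      mul_assoc ν]

lemma mul_qad_of_boson (hgf : g * f = q ^ 2 • (f * g) + (1 - q ^ 2) • 1)
    (hgx : g * x = r • (x * g)) (s : ℕ) :
    g * qad q r f s x = (r * q ^ (2 * s)) • (qad q r f s x * g) := by
  induction s with
  | zero => simp [hgx]
  | succ s ih =>
    rw [qad_succ]
    generalize qad q r f s x = v at *
    simp only [mul_sub, sub_mul, mul_smul_comm, smul_mul_assoc, ← mul_assoc, hgf, ih, add_mul]
    simp only [mul_assoc, hgf, ih, mul_add, mul_smul_comm, mul_one, one_mul]
    module

variable (hfe : f * e = q ^ 2 • (e * f) + (1 - q ^ 2) • 1)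
include hfe

lemma qad_succ_mul_of_boson (hxe : x * e = r • (e * x)) (s : ℕ) :
    qad q r f (s + 1) x * e = (r * q ^ (2 * (s + 1))) • (e * qad q r f (s + 1) x) +
      lowerCoeff q r s • qad q r f s x := by
  have hfe_mul (w : B) : f * (e * w) = q ^ 2 • (e * (f * w)) + (1 - q ^ 2) • w := by
    rw [← mul_assoc, hfe, add_mul, smul_mul_assoc, smul_mul_assoc, one_mul, mul_assoc]
  induction s with
  | zero =>
    have hxe_mul (w : B) : x * (e * w) = r • (e * (x * w)) := by
      rw [← mul_assoc, hxe, smul_mul_assoc, mul_assoc]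
    simp only [qad_succ, qad_zero, lowerCoeff, sub_mul, mul_sub, smul_mul_assoc, mul_assoc, hfe,
      hxe, mul_add, mul_smul_comm, mul_one, hfe_mul, hxe_mul, smul_sub]
    module
  | succ s ih =>
    have hvf : qad q r f s x * f =
        qad q r f (s + 1) x + (r * q ^ (2 * s)) • (f * qad q r f s x) := by
      rw [qad_succ, sub_add_cancel]
    rw [qad_succ q r f x (s + 1)]
    generalize qad q r f (s + 1) x = u at *
    generalize qad q r f s x = v at *
    have hue_mul (w : B) : u * (e * w) =
        (r * q ^ (2 * (s + 1))) • (e * (u * w)) + lowerCoeff q r s • (v * w) := by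
      rw [← mul_assoc, ih, add_mul, smul_mul_assoc, smul_mul_assoc, mul_assoc]
    simp only [sub_mul, mul_sub, smul_mul_assoc, mul_assoc, hfe, ih, mul_add, mul_smul_comm,
      mul_one, hfe_mul, hue_mul, hvf, smul_sub, smul_add, lowerCoeff]
    module

lemma qad_mul_qad_succ (hxe : x * e = r • (e * x)) {s t : ℕ} {c : K}
    (hst : qad q r f (s + 1) x * qad q r' e t y =
      (κ * r' ^ (s + 1) * r ^ t * q ^ (2 * (s + 1) * t)) •
        (qad q r' e t y * qad q r f (s + 1) x))
    (hst' : qad q r f s x * qad q r' e t y =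
      (κ * r' ^ s * r ^ t * q ^ (2 * s * t)) • (qad q r' e t y * qad q r f s x) + c • 1) :
    qad q r f (s + 1) x * qad q r' e (t + 1) y =
      (κ * r' ^ (s + 1) * r ^ (t + 1) * q ^ (2 * (s + 1) * (t + 1))) •
        (qad q r' e (t + 1) y * qad q r f (s + 1) x) +
      (-(r' * q ^ (2 * t)) * lowerCoeff q r s * c) • 1 := by
  have hue := qad_succ_mul_of_boson hfe hxe s
  rw [qad_succ q r' e y t]
  generalize qad q r f (s + 1) x = u at *
  generalize qad q r f s x = v at *
  generalize qad q r' e t y = w at *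
  have huwe : u * (w * e) = (κ * r' ^ (s + 1) * r ^ t * q ^ (2 * (s + 1) * t)) •
      (w * ((r * q ^ (2 * (s + 1))) • (e * u) + lowerCoeff q r s • v)) := by
    rw [← mul_assoc, hst, smul_mul_assoc, mul_assoc w, hue]
  have huew : u * (e * w) = (r * q ^ (2 * (s + 1)) *
      (κ * r' ^ (s + 1) * r ^ t * q ^ (2 * (s + 1) * t))) • (e * (w * u)) +
      lowerCoeff q r s • ((κ * r' ^ s * r ^ t * q ^ (2 * s * t)) • (w * v) + c • 1) := by
    rw [← mul_assoc, hue, add_mul, smul_mul_assoc, smul_mul_assoc, mul_assoc, hst, hst',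
      mul_smul_comm, smul_smul]
  simp only [mul_sub, sub_mul, mul_smul_comm, smul_mul_assoc, mul_assoc, huwe, huew, mul_add,
    smul_sub, smul_add]
  module

lemma qad_mul_qad (hxe : x * e = r • (e * x)) (hxy : x * y = κ • (y * x))
    (hfy : f * y = r' • (y * f)) (s t : ℕ) : qad q r f s x * qad q r' e t y =
      (κ * r' ^ s * r ^ t * q ^ (2 * s * t)) • (qad q r' e t y * qad q r f s x) := by
  induction t generalizing s with
  | zero => simpa using qad_mul_of_comm hxy hfy s
  | succ t ih =>
    cases s with
    | zero => simpa using mul_qad_of_comm hxy hxe (t + 1)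
    | succ s => simpa using qad_mul_qad_succ (c := 0) hfe hxe (ih (s + 1)) (by simpa using ih s)

section Self

variable {c : K} (hxe : x * e = r • (e * x)) (hxy : x * y = κ • (y * x) + c • 1)
  (hfy : f * y = r • (y * f))
include hxy hfy

omit hfe in
lemma qad_succ_mul_of_comm_add (s : ℕ) :
    qad q r f (s + 1) x * y = (κ * r ^ (s + 1)) • (y * qad q r f (s + 1) x) := by
  have hone : qad q r f 1 x * y = (κ * r) • (y * qad q r f 1 x) := by
    have hxfy : x * (f * y) = r • (κ • (y * (x * f)) + c • f) := by
      rw [hfy, mul_smul_comm, ← mul_assoc, hxy, add_mul, smul_mul_assoc, smul_mul_assoc, one_mul,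
        mul_assoc]
    have hfyx : f * (y * x) = r • (y * (f * x)) := by
      rw [← mul_assoc, hfy, smul_mul_assoc, mul_assoc]
    simp only [qad_succ, qad_zero, sub_mul, mul_sub, smul_mul_assoc, mul_assoc, hxy, hxfy, hfyx,
      mul_add, mul_smul_comm, mul_one, smul_sub, smul_add]
    module
  rw [add_comm, qad_add_apply, qad_mul_of_comm hone hfy s, mul_assoc κ, pow_add, pow_one]

include hxe in
lemma qad_mul_qad_of_lt (s t : ℕ) (hts : t < s) : qad q r f s x * qad q r e t y =
    (κ * r ^ s * r ^ t * q ^ (2 * s * t)) • (qad q r e t y * qad q r f s x) := by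
  induction t generalizing s with
  | zero =>
    obtain ⟨s, rfl⟩ := Nat.exists_eq_add_one_of_ne_zero hts.ne'
    simpa using qad_succ_mul_of_comm_add hxy hfy s
  | succ t ih =>
    obtain ⟨s, rfl⟩ := Nat.exists_eq_add_one_of_ne_zero (Nat.ne_zero_of_lt hts)
    simpa using qad_mul_qad_succ (c := 0) hfe hxe (ih (s + 1) (by lia))
      (by simpa using ih s (by lia))

include hxe in
lemma qad_mul_qad_self (s : ℕ) : qad q r f s x * qad q r e s y =
    (κ * r ^ s * r ^ s * q ^ (2 * s * s)) • (qad q r e s y * qad q r f s x) +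
      ((∏ t ∈ Finset.range s, (-(r * q ^ (2 * t)) * lowerCoeff q r t)) * c) • 1 := by
  induction s with
  | zero => simpa using hxy
  | succ s ih =>
    rw [qad_mul_qad_succ hfe hxe (qad_mul_qad_of_lt hfe hxe hxy hfy _ _ s.lt_succ_self) ih,
      Finset.prod_range_succ, ← mul_assoc, mul_comm (_ * lowerCoeff q r s)]

end Self

lemma rqad_qad (hxe : x * e = r • (e * x)) {a : ℕ} (hr : r * q ^ a = 1) (s t : ℕ)
    (hst : s + t = a) : rqad q r e s (qad q r f a x) = lowerProd q r a s • qad q r f t x := by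
  induction s generalizing t with
  | zero => simp [lowerProd, ← hst]
  | succ s ih =>
    have hcancel : r * q ^ (2 * s) * (r * q ^ (2 * (t + 1))) = 1 := by
      calc r * q ^ (2 * s) * (r * q ^ (2 * (t + 1))) = (r * q ^ a) ^ 2 := by rw [← hst]; ring
        _ = 1 := by rw [hr, one_pow]
    rw [rqad_succ, ih (t + 1) (by lia), lowerProd_succ, show a - 1 - s = t by lia,
      mul_smul_comm, smul_mul_assoc, qad_succ_mul_of_boson hfe hxe t]
    generalize r * q ^ (2 * s) = ρ at *
    generalize r * q ^ (2 * (t + 1)) = σ at *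
    match_scalars
    · linear_combination -lowerProd q r a s * hcancel
    · ring

lemma rqad_succ_qad_eq_zero (hxe : x * e = r • (e * x)) {a : ℕ} (hr : r * q ^ a = 1) :
    rqad q r e (a + 1) (qad q r f a x) = 0 := by
  have hcancel : r * q ^ (2 * a) * r = 1 := by
    calc r * q ^ (2 * a) * r = (r * q ^ a) ^ 2 := by ring
      _ = 1 := by rw [hr, one_pow]
  rw [rqad_succ, rqad_qad hfe hxe hr a 0 (by simp), qad_zero, mul_smul_comm, smul_mul_assoc, hxe,
    smul_comm _ r, smul_smul, hcancel, one_smul, sub_self]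

end Boson

section LowerCoeff

variable {q r : K}

lemma prod_range_mul_pow_odd {a : ℕ} (hr : r * q ^ a = 1) :
    ∏ t ∈ Finset.range a, (r * q ^ (2 * t + 1)) = 1 := by
  have prod_odd (n : ℕ) : ∏ t ∈ Finset.range n, q ^ (2 * t + 1) = (q ^ n) ^ n := by
    induction n with
    | zero => simp
    | succ n ih => rw [Finset.prod_range_succ, ih]; ring
  rw [Finset.prod_mul_distrib, Finset.prod_const, Finset.card_range, prod_odd, ← mul_pow, hr,
    one_pow]

/-- The powers of `q` cancel once one of the two products of quantum integers is reflected. -/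
lemma Generic.prod_lowerCoeff (hq : Generic q) {a : ℕ} (hr : r * q ^ a = 1) :
    ∏ t ∈ Finset.range a, (-(r * q ^ (2 * t)) * lowerCoeff q r t) =
      qFac q a ^ 2 * ((q - q⁻¹) ^ 2 / q) ^ a := by
  have hq0 := hq.ne_zero
  have hq1 : q ^ 2 - 1 ≠ 0 := sub_ne_zero.mpr (hq.pow_ne_one 2 two_pos)
  have factor {t : ℕ} (ht : t ∈ Finset.range a) : -(r * q ^ (2 * t)) * lowerCoeff q r t =
      (r * q ^ (2 * t + 1)) * (q ^ (t + 1) * qNum q (t + 1)) *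
        ((q ^ (a - 1 - t + 1))⁻¹ * qNum q (a - 1 - t + 1)) * ((q - q⁻¹) ^ 2 / q) := by
    obtain ⟨s, rfl⟩ := Nat.exists_eq_add_of_lt (Finset.mem_range.mp ht)
    rw [eq_inv_of_mul_eq_one_left hr, show t + s + 1 - 1 - t = s by lia]
    simp only [qNum, lowerCoeff]
    field_simp
    ring
  have hprod : ∏ t ∈ Finset.range a, q ^ (t + 1) ≠ 0 :=
    Finset.prod_ne_zero_iff.mpr fun t _ => pow_ne_zero _ hq0
  rw [Finset.prod_congr rfl fun t => factor, Finset.prod_mul_distrib, Finset.prod_mul_distrib,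
    Finset.prod_mul_distrib, prod_range_mul_pow_odd hr,
    Finset.prod_range_reflect fun t => (q ^ (t + 1))⁻¹ * qNum q (t + 1), Finset.prod_mul_distrib,
    Finset.prod_mul_distrib, Finset.prod_inv_distrib, Finset.prod_const, Finset.card_range, qFac]
  field_simp

lemma lowerProd_factor_reflect {a : ℕ} (hr : r * q ^ a = 1) {u : ℕ} (hu : u < a) :
    -(r * q ^ (2 * (a - 1 - u))) * lowerCoeff q r (a - 1 - (a - 1 - u)) =
      -(r * q ^ (2 * u)) * lowerCoeff q r (a - 1 - u) := by
  obtain ⟨v, rfl⟩ := Nat.exists_eq_add_of_lt hu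
  have hq : q ≠ 0 := ne_zero_pow (Nat.succ_ne_zero _) (right_ne_zero_of_mul_eq_one hr)
  rw [eq_inv_of_mul_eq_one_left hr, show u + v + 1 - 1 - u = v by lia,
    show u + v + 1 - 1 - v = u by lia, lowerCoeff, lowerCoeff]
  field_simp
  ring

lemma lowerProd_mul_lowerProd {a : ℕ} (hr : r * q ^ a = 1) {s t : ℕ} (hst : s + t = a) :
    lowerProd q r a s * lowerProd q r a t = lowerProd q r a a := by
  conv_rhs => rw [lowerProd, ← hst, Finset.prod_range_add, ← Finset.prod_range_reflect _ t]
  rw [hst]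
  refine congrArg _ (Finset.prod_congr rfl fun u hu => ?_)
  have hut := Finset.mem_range.mp hu
  rw [← lowerProd_factor_reflect hr (hut.trans_le (hst ▸ Nat.le_add_left t s)),
    show s + (t - 1 - u) = a - 1 - u by lia]

lemma lowerProd_self (q r : K) (a : ℕ) : lowerProd q r a a =
    ∏ t ∈ Finset.range a, (-(r * q ^ (2 * t)) * lowerCoeff q r t) := by
  rw [lowerProd, Finset.prod_mul_distrib, Finset.prod_mul_distrib,
    Finset.prod_range_reflect (lowerCoeff q r)]

end LowerCoeff

/-! ### Exchanging the generators in the Serre relation -/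

section SerreSwap

variable {p q r : K} {e f x : B}

lemma qad_commutator (q r : K) (f x : B) (c : K) (s : ℕ) :
    qad q r f s (x * f - c • (f * x)) = qad q r f s x * f - c • (f * qad q r f s x) := by
  induction s with
  | zero => rfl
  | succ s ih =>
    simp only [qad_succ, ih, sub_mul, mul_sub, smul_mul_assoc, mul_smul_comm, mul_assoc]
    module

lemma qad_qad_one_eq_zero {n : ℕ} (hr : r * p ^ n = 1) (hf : qad p r x (n + 1) f = 0) :
    qad p r x n (qad q r f 1 x) = 0 := by
  have hcancel : r * p ^ (2 * n) * r = 1 := by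
    calc r * p ^ (2 * n) * r = (r * p ^ n) ^ 2 := by ring
      _ = 1 := by rw [hr, one_pow]
  have hswap : qad q r f 1 x = -r • (f * x - (r * p ^ (2 * n)) • (x * f)) := by
    rw [qad_succ, qad_zero, mul_zero, pow_zero, mul_one]
    match_scalars
    · linear_combination -hcancel
    · ring
  rw [hswap, map_smul, qad_commutator, ← qad_succ, hf, smul_zero]

lemma qad_qad_succ_eq_smul (hfe : f * e = q ^ 2 • (e * f) + (1 - q ^ 2) • 1)
    (hxe : x * e = r • (e * x)) {a : ℕ} (hr : r * q ^ (a + 1) = 1) :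
    qad p r (qad q r f (a + 1) x) 1 e = (-r * lowerCoeff q r a) • qad q r f a x := by
  have hcancel : r * (r * q ^ (2 * (a + 1))) = 1 := by
    linear_combination (r * q ^ (a + 1) + 1) * hr
  rw [qad_succ, qad_zero, qad_succ_mul_of_boson hfe hxe, mul_zero, pow_zero, mul_one, smul_add,
    smul_smul, hcancel]
  module

variable (hq : Generic q)
include hq

lemma Generic.qNum_one : qNum q 1 = 1 := by
  rw [qNum, pow_one, div_self hq.sub_inv_ne_zero]

lemma Generic.qadDiv_qad_one (s : ℕ) :
    qadDiv q (r * q ^ 2) f s (qad q r f 1 x) = qNum q (s + 1) • qadDiv q r f (s + 1) x := by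
  rw [qadDiv_apply, qadDiv_apply, qFac_succ, mul_inv_rev, mul_smul,
    smul_inv_smul₀ (hq.qNum_ne_zero s.succ_pos), add_comm s, qad_add_apply, mul_one]

lemma Generic.qadDiv_commutator (hr : r ≠ 0) (N : ℕ) :
    qadDiv q (r * (r * q ^ 2)) f N (qad q r f 1 x * x - r • (x * qad q r f 1 x)) =
      ∑ p ∈ antidiagonal (N + 1), (r⁻¹ * r ^ p.1 * q ^ (p.1 * p.2) * (q ^ p.2)⁻¹ *
        (qNum q p.1 - r ^ 2 * q ^ (p.1 + p.2) * qNum q p.2)) •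
          (qadDiv q r f p.1 x * qadDiv q r f p.2 x) := by
  have hq0 := hq.ne_zero
  have hleft : qadDiv q (r * (r * q ^ 2)) f N (qad q r f 1 x * x) =
      ∑ p ∈ antidiagonal N, (r ^ p.1 * q ^ (p.1 * p.2) * qNum q (p.1 + 1)) •
        (qadDiv q r f (p.1 + 1) x * qadDiv q r f p.2 x) := by
    simp only [mul_comm r (r * q ^ 2), hq.qadDiv_mul, hq.qadDiv_qad_one, smul_mul_assoc, mul_smul]
  have hright : qadDiv q (r * (r * q ^ 2)) f N (x * qad q r f 1 x) =
      ∑ p ∈ antidiagonal N, ((r * q ^ 2) ^ p.1 * q ^ (p.1 * p.2) * qNum q (p.2 + 1)) •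
        (qadDiv q r f p.1 x * qadDiv q r f (p.2 + 1) x) := by
    simp only [hq.qadDiv_mul, hq.qadDiv_qad_one, mul_smul_comm, mul_smul]
  simp only [mul_sub, sub_smul, Finset.sum_sub_distrib, map_sub, map_smul, hleft, hright,
    Finset.smul_sum]
  congr 1
  · rw [Finset.Nat.sum_antidiagonal_succ, qNum_zero, mul_zero, zero_smul, zero_add]
    refine Finset.sum_congr rfl fun p _ => ?_
    congr 1
    field_simp
    ring
  · rw [Finset.Nat.sum_antidiagonal_succ', qNum_zero, mul_zero, mul_zero, mul_zero, zero_smul,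
      zero_add]
    refine Finset.sum_congr rfl fun p _ => ?_
    rw [smul_smul]
    congr 1
    field_simp
    ring

omit hq in
lemma isTopPower_qadDiv {n : ℕ} (hr : r = q⁻¹ ^ n) (hx : qad q r f (n + 1) x = 0) :
    IsTopPower q 1 f n x (qadDiv q r f n x) := by
  subst hr
  exact ⟨by rw [one_pow, one_smul], hx⟩

variable {a : ℕ} (hr : r * q ^ (a + 1) = 1) (hx : qad q r f (a + 2) x = 0)
include hr hx

lemma Generic.qadDiv_two_mul_commutator : qadDiv q (r * (r * q ^ 2)) f (2 * a)
    (qad q r f 1 x * x - r • (x * qad q r f 1 x)) =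
      qadDiv q r f (a + 1) x * qadDiv q r f a x -
        r • (qadDiv q r f a x * qadDiv q r f (a + 1) x) := by
  have hq0 := hq.ne_zero
  have hr0 : r ≠ 0 := left_ne_zero_of_mul_eq_one hr
  have hpow : r ^ a * q ^ (a * (a + 1)) = 1 := by rw [mul_comm a, pow_mul, ← mul_pow, hr, one_pow]
  have hrq : r ^ 2 * q ^ (a + (a + 1)) = q⁻¹ := by
    rw [← mul_eq_one_iff_eq_inv₀ hq0]
    linear_combination (r * q ^ (a + 1) + 1) * hr
  have hr_inv : r = (q ^ (a + 1))⁻¹ := eq_inv_of_mul_eq_one_left hr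
  have hlow : qNum q (a + 1) - q⁻¹ * qNum q a = q ^ a := by
    rw [add_comm, qNum_add, hq.qNum_one, pow_one, mul_one, add_sub_cancel_left]
  have hhigh : qNum q a - q⁻¹ * qNum q (a + 1) = -r := by
    rw [qNum_add, hq.qNum_one, pow_one, mul_one, hr_inv, pow_succ, mul_inv]
    field_simp
    ring
  have vanish (p : ℕ × ℕ) (hp : a + 1 < p.1 ∨ a + 1 < p.2) :
      qadDiv q r f p.1 x * qadDiv q r f p.2 x = 0 := by
    rcases hp with hp | hp <;> simp only [qadDiv_apply, qad_eq_zero_of_le hx hp, smul_zero,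
      zero_mul, mul_zero]
  rw [hq.qadDiv_commutator hr0, Finset.sum_eq_add (a + 1, a) (a, a + 1) (by simp)]
  · dsimp only
    rw [add_comm (a + 1) a, hrq, hlow, hhigh, mul_comm (a + 1) a, ← hr_inv, pow_succ r]
    match_scalars
    · field_simp
      linear_combination hpow
    · field_simp
      linear_combination -hpow
  · rintro ⟨s, t⟩ hst hne
    simp only [ne_eq, Prod.mk.injEq, mem_antidiagonal] at hne hst
    rw [vanish _ (by lia), smul_zero]
  all_goals exact fun h => (h (mem_antidiagonal.mpr (by lia))).elim

lemma Generic.qadDiv_two_mul_succ_commutator : qadDiv q (r * (r * q ^ 2)) f (2 * a + 1)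
    (qad q r f 1 x * x - r • (x * qad q r f 1 x)) = 0 := by
  rw [hq.qadDiv_commutator (left_ne_zero_of_mul_eq_one hr)]
  refine Finset.sum_eq_zero fun ⟨s, t⟩ hst => ?_
  rw [mem_antidiagonal] at hst
  obtain hs | ht | ⟨rfl, rfl⟩ : a + 1 < s ∨ a + 1 < t ∨ s = a + 1 ∧ t = a + 1 := by lia
  · rw [qadDiv_apply _ _ _ _ s, qad_eq_zero_of_le hx hs, smul_zero, zero_mul, smul_zero]
  · rw [qadDiv_apply _ _ _ _ t, qad_eq_zero_of_le hx ht, smul_zero, mul_zero, smul_zero]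
  · have hsq : r ^ 2 * q ^ (a + 1 + (a + 1)) = 1 := by
      linear_combination (r * q ^ (a + 1) + 1) * hr
    dsimp only
    rw [hsq, one_mul, sub_self, mul_zero, zero_smul]

lemma isTopPower_commutator :
    IsTopPower q 1 f (2 * a) (qad q r f 1 x * x - r • (x * qad q r f 1 x))
      (qadDiv q r f (a + 1) x * qadDiv q r f a x -
        r • (qadDiv q r f a x * qadDiv q r f (a + 1) x)) := by
  have hparam : q⁻¹ ^ (2 * a) = r * (r * q ^ 2) := by
    rw [inv_pow, eq_comm, ← mul_eq_one_iff_eq_inv₀ (pow_ne_zero _ hq.ne_zero)]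
    linear_combination (r * q ^ (a + 1) + 1) * hr
  rw [IsTopPower, hparam, one_pow, one_smul]
  exact ⟨hq.qadDiv_two_mul_commutator hr hx,
    (smul_eq_zero.mp (hq.qadDiv_two_mul_succ_commutator hr hx)).resolve_left
      (inv_ne_zero (hq.qFac_ne_zero _))⟩

/-- Reflecting the Serre relation: top powers are multiplicative, so they turn the Serre element in
`x₀` and `x₁` into the one in `x_{a+1}` and `x_a`. -/
lemma qad_qad_succ_qad_eq_zero {b : ℕ} (hr' : r * p ^ (b + 1) = 1)
    (hxx : qad p r x (b + 1) (qad q r f 1 x) = 0) :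
    qad p (r * p ^ 2) (qad q r f (a + 1) x) (b + 1) (qad q r f a x) = 0 := by
  have hr0 : r ≠ 0 := left_ne_zero_of_mul_eq_one hr
  have hrinv : r * p ^ 2 * p ^ (2 * b) = r⁻¹ := by
    rw [← mul_eq_one_iff_eq_inv₀ hr0]
    linear_combination (r * p ^ (b + 1) + 1) * hr'
  have hxtop : IsTopPower q 1 f (a + 1) x (qadDiv q r f (a + 1) x) :=
    isTopPower_qadDiv (by rw [inv_pow]; exact eq_inv_of_mul_eq_one_left hr) hx
  have htop := hxtop.qad hq (isTopPower_commutator hq hr hx) p (r * p ^ 2) b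
  set u := qad q r f (a + 1) x with hu
  set v := qad q r f a x with hv
  have hcomm : qad q r f 1 x * x - r • (x * qad q r f 1 x) = qad p r x 1 (qad q r f 1 x) := by
    rw [qad_succ p, qad_zero, mul_zero, pow_zero, mul_one]
  rw [hcomm, ← mul_one 2, ← qad_add_apply, add_comm 1, hxx] at htop
  have hreflect : qadDiv q r f (a + 1) x * qadDiv q r f a x -
      r • (qadDiv q r f a x * qadDiv q r f (a + 1) x) =
        (-((qFac q (a + 1))⁻¹ * (qFac q a)⁻¹ * r)) • (v * u - r⁻¹ • (u * v)) := by
    simp only [qadDiv_apply, ← hu, ← hv, smul_mul_smul_comm]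
    match_scalars <;> field_simp
  have hzero := htop.unique one_ne_zero .zero
  rw [hreflect, map_smul, qadDiv_apply, qad_smul_left, smul_smul] at hzero
  rw [qad_succ, hrinv, ← qad_commutator]
  refine (smul_eq_zero.mp hzero).resolve_left (mul_ne_zero (neg_ne_zero.mpr ?_) ?_)
  · exact mul_ne_zero (mul_ne_zero (inv_ne_zero (hq.qFac_ne_zero _))
      (inv_ne_zero (hq.qFac_ne_zero _))) hr0
  · exact pow_ne_zero _ (inv_ne_zero (hq.qFac_ne_zero _))

omit hr hx in
/-- As `qad p r x_a 1 e` is a multiple of `x_{a-1}`, this amounts to a Serre relation between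
`x_a` and `x_{a-1}`. -/
theorem qad_qad_eq_zero {a n : ℕ} (hr : r * q ^ a = 1) (hr' : r * p ^ n = 1)
    (hfe : f * e = q ^ 2 • (e * f) + (1 - q ^ 2) • 1) (hxe : x * e = r • (e * x))
    (hx : qad q r f (a + 1) x = 0) (hf : qad p r x (n + 1) f = 0) :
    qad p r (qad q r f a x) (n + 1) e = 0 := by
  match a, n with
  | 0, n =>
    rw [pow_zero, mul_one] at hr
    refine qad_eq_zero_of_le (n := 1) ?_ (by lia)
    simp [qad_succ, hxe, hr]
  | a + 1, 0 =>
    rw [pow_zero, mul_one] at hr'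
    rw [hr', one_mul] at hr
    exact absurd hr (hq.pow_ne_one _ a.succ_pos)
  | a + 1, b + 1 =>
    rw [add_comm (b + 1), qad_add_apply, mul_one, qad_qad_succ_eq_smul hfe hxe hr, map_smul,
      qad_qad_succ_qad_eq_zero hq hr hx hr' (qad_qad_one_eq_zero hr' hf), smul_zero]

end SerreSwap

/-! ### Commutator identities for the braid relations -/

lemma qad_one (q r : K) (f x : B) : qad q r f 1 x = x * f - r • (f * x) := by
  rw [qad_succ, qad_zero, mul_zero, pow_zero, mul_one]

lemma rqad_one (q r : K) (f x : B) : rqad q r f 1 x = f * x - r • (x * f) := by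
  rw [rqad_succ, rqad_zero, mul_zero, pow_zero, mul_one]

lemma qad_one_eq_rqad_one (p q r : K) (f x : B) : qad p r f 1 x = rqad q r x 1 f := by
  rw [qad_one, rqad_one]

lemma qad_two (q r : K) (f x : B) :
    qad q r f 2 x = qad q (r * q ^ 2) f 1 (qad q r f 1 x) := by
  rw [qad_succ, qad_one _ (r * q ^ 2), mul_one]

lemma rqad_two (q r : K) (f x : B) :
    rqad q r f 2 x = rqad q (r * q ^ 2) f 1 (rqad q r f 1 x) := by
  rw [rqad_succ, rqad_one _ (r * q ^ 2), mul_one]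

lemma qad_mul_sub_smul_mul {f g : B} (h : Commute f g) (q r c : K) (x : B) (s : ℕ) :
    qad q r g s (x * f - c • (f * x)) = qad q r g s x * f - c • (f * qad q r g s x) := by
  induction s with
  | zero => rfl
  | succ s ih =>
    rw [qad_succ, qad_succ, ih]
    simp only [mul_sub, sub_mul, mul_smul_comm, smul_mul_assoc, mul_assoc, h.eq, h.left_comm]
    module

lemma qad_qad_comm {f g : B} (h : Commute f g) (q r p ρ : K) (x : B) (s t : ℕ) :
    qad q r f t (qad p ρ g s x) = qad p ρ g s (qad q r f t x) := by
  induction t with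
  | zero => rfl
  | succ t ih => rw [qad_succ, qad_succ, qad_mul_sub_smul_mul h, ih]

lemma qad_rqad_eq_of_short {q p' p r : K} {f g x : B} (hp : p * q = 1) (hr : r * q ^ 2 = 1)
    (hxg : Commute x g) (hS : qad q p f 2 x = 0) :
    qad q p (rqad p' r g 1 f) 1 (qad q p f 1 x) = qad q p f 1 (qad q p (qad p' r g 1 f) 1 x) := by
  have hq : q ≠ 0 := right_ne_zero_of_mul_eq_one hp
  obtain rfl : p = q⁻¹ := eq_inv_of_mul_eq_one_left hp
  obtain rfl : r = (q ^ 2)⁻¹ := eq_inv_of_mul_eq_one_left hr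
  rw [← sub_eq_zero]
  calc _ = (q ^ 2)⁻¹ • (g * qad q q⁻¹ f 2 x) - (q ^ 2)⁻¹ • (qad q q⁻¹ f 2 x * g) := by
        simp only [qad_one, rqad_one, qad_two, mul_sub, sub_mul, mul_smul_comm, smul_mul_assoc,
          mul_assoc, hxg.eq, hxg.left_comm]
        match_scalars <;> field_simp <;> ring
    _ = 0 := by rw [hS, mul_zero, zero_mul, smul_zero, sub_zero]

/-- Here `1 + p ^ 2` times the difference of the two sides is a combination of multiples of the two
vanishing commutators, with coefficients found by solving the linear system on words. -/
lemma qad_rqad_eq_of_long {q p p' : K} {f g x : B} (hp : p * p' = 1) (hr : p * q ^ 2 = 1)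
    (hp2 : 1 + p ^ 2 ≠ 0) (hxf : Commute x f) (hS : qad p' p g 2 x = 0)
    (hR : qad p' p g 2 f = 0) :
    qad p' p (rqad q p f 2 g) 1 (qad p' p g 1 x) =
      qad p' p g 1 (qad p' p (qad q p f 2 g) 1 x) := by
  have hp0 : p ≠ 0 := left_ne_zero_of_mul_eq_one hp
  obtain rfl : p' = p⁻¹ := eq_inv_of_mul_eq_one_right hp
  rw [← sub_eq_zero, ← (smul_right_injective B hp2).eq_iff, smul_zero]
  calc _ = (p ^ 2 * (1 - p)) • (f * (f * qad p⁻¹ p g 2 x) - qad p⁻¹ p g 2 x * (f * f)) -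
        (p * (1 + p)) • (f * (x * qad p⁻¹ p g 2 f) - x * (qad p⁻¹ p g 2 f * f)) +
        (p ^ 3 * (1 + p)) • (f * (qad p⁻¹ p g 2 f * x) - qad p⁻¹ p g 2 f * (f * x)) := by
        simp only [qad_one, qad_two, rqad_two, rqad_one, hr, one_smul, mul_sub, sub_mul,
          mul_smul_comm, smul_mul_assoc, mul_assoc, hxf.eq, hxf.left_comm]
        match_scalars <;> field_simp <;> ring
    _ = 0 := by simp [hS, hR]

end QuantumAdjoint

namespace SimpleCartanDatum

open QuantumAdjoint

open CoxeterSystem (alternatingWord)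

variable {I : Type*} [Fintype I] {D : SimpleCartanDatum I}

section Relations

lemma qHalf_ne_zero (e : ℤ) : qHalf e ≠ 0 := zpow_ne_zero _ RatFunc.X_ne_zero

lemma qHalf_add (a b : ℤ) : qHalf (a + b) = qHalf a * qHalf b := zpow_add₀ RatFunc.X_ne_zero _ _

lemma qHalf_mul_nat (a : ℤ) (n : ℕ) : qHalf (a * n) = qHalf a ^ n := by
  rw [qHalf, zpow_mul, zpow_natCast, qHalf]

lemma qPow_ne_zero (e : ℤ) : qPow e ≠ 0 := qHalf_ne_zero _

lemma qPow_add (a b : ℤ) : qPow (a + b) = qPow a * qPow b := by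
  rw [qPow, mul_add, qHalf_add, qPow, qPow]

lemma qPow_mul_nat (a : ℤ) (n : ℕ) : qPow (a * n) = qPow a ^ n := by
  rw [qPow, qPow, ← mul_assoc, qHalf_mul_nat]

@[simp] lemma qPow_zero : qPow 0 = 1 := by simp [qPow, qHalf]

lemma qPow_neg (a : ℤ) : qPow (-a) = (qPow a)⁻¹ := by
  rw [qPow, qPow, qHalf, qHalf, mul_neg, zpow_neg]

lemma qPow_eq_qHalf_sq (a : ℤ) : qPow a = qHalf a ^ 2 := by
  rw [qPow, mul_comm, ← Nat.cast_two, qHalf_mul_nat]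

variable (D)

/-- `q_i = q^{d_i}`. -/
def qi (i : I) : QField := qPow (D.d i)

lemma qi_pow (i : I) (n : ℕ) : D.qi i ^ n = qPow (D.d i * n) := (qPow_mul_nat _ _).symm

lemma generic_qi (i : I) : Generic (D.qi i) where
  ne_zero := qPow_ne_zero _
  pow_ne_one n hn h := by
    have hX : (RatFunc.X : RatFunc ℚ) ^ (2 * (D.d i * n)) = 1 := by
      rw [← h, qi_pow, qPow, qHalf, ← zpow_natCast]
      congr 1
    rw [← RatFunc.algebraMap_X, ← map_pow,
      ← map_one (algebraMap (Polynomial ℚ) (RatFunc ℚ))] at hX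
    have hdeg := congrArg Polynomial.natDegree (RatFunc.algebraMap_injective ℚ hX)
    rw [Polynomial.natDegree_X_pow, Polynomial.natDegree_one] at hdeg
    exact (Nat.mul_pos two_pos (Nat.mul_pos (D.d_pos i) hn)).ne' hdeg

lemma qDiff_eq (i : I) : D.qDiff i = D.qi i - (D.qi i)⁻¹ := by rw [qDiff, qPow_neg, qi]

lemma qInt_eq (i : I) (n : ℕ) : D.qInt i n = qNum (D.qi i) n := by
  rw [qInt, qNum, qDiff_eq, qPow_neg, qi_pow]

lemma qFactorial_eq (i : I) (n : ℕ) : D.qFactorial i n = qFac (D.qi i) n := by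
  simp only [qFactorial, qFac, qInt_eq]

lemma yDiv_eq (i : I) (m : ℤ) (k : ℕ) : D.yDiv i m k = dpow (D.qi i) (D.y i m) k := by
  rw [yDiv, dpow, qFactorial_eq]

lemma qi_sq (i : I) : D.qi i ^ 2 = qPow (D.form i i) := by
  rw [qi_pow, form_self, Nat.cast_two, mul_comm]

variable {D} in
lemma negC_cast {i j : I} (hij : i ≠ j) : (D.negC i j : ℤ) = -D.C i j :=
  Int.toNat_of_nonneg (by have := D.off_diag i j hij; lia)

variable {D} in
lemma form_eq {i j : I} (hij : i ≠ j) : D.form i j = -(D.d i * D.negC i j) := by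
  rw [negC_cast hij, form, mul_neg, neg_neg]

variable {D} in
lemma qPow_form_mul {i j : I} (hij : i ≠ j) : qPow (D.form i j) * D.qi i ^ D.negC i j = 1 := by
  rw [qi_pow, ← qPow_add, form_eq hij, neg_add_cancel, qPow_zero]

variable {D} in
lemma qPow_form_eq {i j : I} (hij : i ≠ j) : qPow (D.form i j) = (D.qi i)⁻¹ ^ D.negC i j := by
  rw [inv_pow]
  exact eq_inv_of_mul_eq_one_left (qPow_form_mul hij)

/-- The scalar `(q_i - q_i⁻¹) q_i^{-1/2}`; its `-c_{i,j}`-th power normalizes `T_i(y_{j,m})`. -/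
def eta (i : I) : QField := D.qDiff i / qHalf (D.d i)

lemma eta_ne_zero (i : I) : D.eta i ≠ 0 := by
  rw [eta, qDiff_eq]
  exact div_ne_zero (D.generic_qi i).sub_inv_ne_zero (qHalf_ne_zero _)

lemma eta_sq (i : I) : D.eta i ^ 2 = (D.qi i - (D.qi i)⁻¹) ^ 2 / D.qi i := by
  rw [eta, div_pow, qDiff_eq, ← qPow_eq_qHalf_sq, qi]

/-- The scalar in front of the iterated `q`-commutator of length `a = -c_{i,j}` that is equal to
`T_i(y_{j,m})`. -/
def braidScalar (i : I) (a : ℕ) : QField := (qFac (D.qi i) a * D.eta i ^ a)⁻¹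

@[simp] lemma braidScalar_zero (i : I) : D.braidScalar i 0 = 1 := by simp [braidScalar]

lemma qFac_mul_eta_pow_ne_zero (i : I) (a : ℕ) : qFac (D.qi i) a * D.eta i ^ a ≠ 0 :=
  mul_ne_zero ((D.generic_qi i).qFac_ne_zero a) (pow_ne_zero a (D.eta_ne_zero i))

lemma braidScalar_sq_mul_prod (i : I) {a : ℕ} {r : QField} (hr : r * D.qi i ^ a = 1) :
    D.braidScalar i a ^ 2 *
      ∏ t ∈ Finset.range a, (-(r * D.qi i ^ (2 * t)) * lowerCoeff (D.qi i) r t) = 1 := by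
  rw [(D.generic_qi i).prod_lowerCoeff hr, ← eta_sq, ← pow_mul, mul_comm 2, pow_mul, ← mul_pow,
    ← mul_pow, braidScalar, inv_mul_cancel₀ (D.qFac_mul_eta_pow_ne_zero i a), one_pow]

lemma y_same (i : I) (k : ℤ) : D.y i k * D.y i (k + 1) =
    D.qi i ^ 2 • (D.y i (k + 1) * D.y i k) + (1 - D.qi i ^ 2) • 1 := by
  have := RingQuot.mkAlgHom_rel QField (Rel.boson_same (D := D) i k)
  rw [map_mul, map_add, map_smul, map_mul, AlgHom.commutes, Algebra.algebraMap_eq_smul_one] at this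
  rw [qi_sq]
  exact this

variable {D} in
lemma y_next {i j : I} (hij : i ≠ j) (k : ℤ) : D.y i k * D.y j (k + 1) =
    qPow (D.form i j) • (D.y j (k + 1) * D.y i k) := by
  have := RingQuot.mkAlgHom_rel QField (Rel.boson_next (D := D) i j k hij)
  rw [map_mul, map_smul, map_mul] at this
  exact this

lemma y_far (i j : I) {k l : ℤ} (hkl : k + 1 < l) : D.y i k * D.y j l =
    qPow (((k + l + 1).negOnePow : ℤ) * D.form i j) • (D.y j l * D.y i k) := by
  have := RingQuot.mkAlgHom_rel QField (Rel.boson_far (D := D) i j k l hkl)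
  rw [map_mul, map_smul, map_mul] at this
  exact this

section Presentation

variable {B : Type*} [Ring B] [Algebra QField B]

/-- The left-hand side of the quantum Serre relation, evaluated at elements `u`, `v` of any
algebra. -/
def serreSum (i j : I) (u v : B) : B :=
  ∑ s ∈ Finset.range (D.negC i j + 2), ((-1) ^ s * D.qBinom i (D.negC i j + 1) s) •
    (u ^ (D.negC i j + 1 - s) * v * u ^ s)

variable {D} in
lemma serreSum_eq {i j : I} (hij : i ≠ j) (u v : B) : D.serreSum i j u v =
    rqad (D.qi i) (qPow (D.form i j)) u (D.negC i j + 1) v := by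
  have hq := D.generic_qi i
  have expansion := hq.rqad_eq_sum (qPow (D.form i j)) u v (D.negC i j + 1)
  rw [inv_smul_eq_iff₀ (hq.qFac_ne_zero _), hq.neg_mul_inv_mul_pow_succ (qPow_form_mul hij),
    Finset.Nat.sum_antidiagonal_eq_sum_range_succ_mk, Finset.smul_sum] at expansion
  rw [expansion, serreSum]
  refine Finset.sum_congr rfl fun s _ => ?_
  simp only [qBinom, qFactorial_eq, dpow, smul_mul_assoc, mul_smul_comm, smul_smul]
  congr 1
  have := hq.qFac_ne_zero s
  have := hq.qFac_ne_zero (D.negC i j + 1 - s)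
  field_simp

/-- An assignment of elements of an algebra to the generators that satisfies the defining
relations of `Â_q(𝔫)`. -/
structure IsSolution (φ : I → ℤ → B) : Prop where
  serre : ∀ i j k, i ≠ j → D.serreSum i j (φ i k) (φ j k) = 0
  same : ∀ i k, φ i k * φ i (k + 1) =
    D.qi i ^ 2 • (φ i (k + 1) * φ i k) + (1 - D.qi i ^ 2) • 1
  next : ∀ i j k, i ≠ j → φ i k * φ j (k + 1) = qPow (D.form i j) • (φ j (k + 1) * φ i k)
  far : ∀ i j k l, k + 1 < l → φ i k * φ j l =
    qPow (((k + l + 1).negOnePow : ℤ) * D.form i j) • (φ j l * φ i k)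

variable {D}

/-- The homomorphism from `Â_q(𝔫)` that takes the values of a given solution on the generators. -/
def IsSolution.lift {φ : I → ℤ → B} (h : D.IsSolution φ) : D.AHat →ₐ[QField] B :=
  RingQuot.liftAlgHom QField ⟨FreeAlgebra.lift QField fun x : I × ℤ => φ x.1 x.2, by
    intro x y hxy
    cases hxy with
    | serre i j k hij =>
      rw [map_zero, ← h.serre i j k hij, map_sum, serreSum]
      simp only [gen, map_smul, map_mul, map_pow, FreeAlgebra.lift_ι_apply]
    | boson_same i k =>
      simp only [gen, map_add, map_smul, map_mul, FreeAlgebra.lift_ι_apply, AlgHom.commutes]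
      rw [h.same, qi_sq, Algebra.algebraMap_eq_smul_one]
    | boson_next i j k hij =>
      simp only [gen, map_smul, map_mul, FreeAlgebra.lift_ι_apply]
      exact h.next i j k hij
    | boson_far i j k l hkl =>
      simp only [gen, map_smul, map_mul, FreeAlgebra.lift_ι_apply]
      exact h.far i j k l hkl⟩

@[simp] lemma IsSolution.lift_y {φ : I → ℤ → B} (h : D.IsSolution φ) (i : I) (m : ℤ) :
    h.lift (D.y i m) = φ i m := by
  simp [lift, y, gen]

lemma algHom_ext {φ ψ : D.AHat →ₐ[QField] B} (h : ∀ i m, φ (D.y i m) = ψ (D.y i m)) : φ = ψ := by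
  apply RingQuot.ringQuot_ext'
  apply FreeAlgebra.hom_ext
  ext ⟨i, m⟩
  exact h i m

end Presentation

variable {D}

lemma serreSum_y {i j : I} (hij : i ≠ j) (k : ℤ) : D.serreSum i j (D.y i k) (D.y j k) = 0 := by
  have := RingQuot.mkAlgHom_rel QField (Rel.serre (D := D) i j k hij)
  rw [map_zero, map_sum] at this
  rw [← this, serreSum]
  simp only [map_smul, map_mul, map_pow]
  rfl

lemma rqad_y_eq_zero {i j : I} (hij : i ≠ j) (k : ℤ) :
    rqad (D.qi i) (qPow (D.form i j)) (D.y i k) (D.negC i j + 1) (D.y j k) = 0 := by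
  rw [← serreSum_eq hij, serreSum_y hij]

lemma qad_y_eq_zero {i j : I} (hij : i ≠ j) (k : ℤ) :
    qad (D.qi i) (qPow (D.form i j)) (D.y i k) (D.negC i j + 1) (D.y j k) = 0 := by
  rw [(D.generic_qi i).qad_eq_zero_iff _ _ _ (qPow_form_mul hij), rqad_y_eq_zero hij]

section BraidImage

variable [DecidableEq I]

variable (D) in
@[simp] lemma braidImage_self (i : I) (m : ℤ) : D.braidImage i i m = D.y i (m + 1) := by
  simp [braidImage, D.diag]

variable (D) in
@[simp] lemma braidInvImage_self (i : I) (m : ℤ) : D.braidInvImage i i m = D.y i (m - 1) := by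
  simp [braidInvImage, D.diag]

omit [DecidableEq I] in
lemma eta_pow_inv_mul_coeff {i j : I} (hij : i ≠ j) (k : ℕ) : (D.eta i ^ D.negC i j)⁻¹ *
    (-(qPow (D.form i j) * (D.qi i)⁻¹ * D.qi i ^ D.negC i j)) ^ k =
      (D.qDiff i ^ D.negC i j)⁻¹ *
        ((-1) ^ k * qHalf ((D.d i : ℤ) * (D.negC i j - 2 * k))) := by
  have hqHalf : qHalf ((D.d i : ℤ) * (D.negC i j - 2 * k)) =
      qHalf (D.d i) ^ D.negC i j * (D.qi i)⁻¹ ^ k := by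
    rw [← qHalf_mul_nat, qi, ← qPow_neg, ← qPow_mul_nat, qPow, ← qHalf_add]
    congr 1
    ring
  rw [mul_right_comm, qPow_form_mul hij, one_mul, neg_pow, hqHalf, eta, div_pow]
  have := pow_ne_zero (D.negC i j) (qHalf_ne_zero (D.d i))
  field_simp

lemma braidImage_of_ne {i j : I} (hij : i ≠ j) (m : ℤ) : D.braidImage i j m =
    D.braidScalar i (D.negC i j) •
      qad (D.qi i) (qPow (D.form i j)) (D.y i m) (D.negC i j) (D.y j m) := by
  rw [braidImage, if_neg hij]
  split_ifs with hC
  · have : D.negC i j = 0 := by have := negC_cast (D := D) hij; lia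
    simp [this]
  · rw [braidScalar, mul_inv, mul_comm, mul_smul, ← qadDiv_apply, (D.generic_qi i).qadDiv_eq_sum,
      Finset.Nat.sum_antidiagonal_eq_sum_range_succ_mk, Finset.smul_sum, Finset.smul_sum]
    refine Finset.sum_congr rfl fun k _ => ?_
    rw [yDiv_eq, yDiv_eq, smul_smul, smul_smul, eta_pow_inv_mul_coeff hij]

lemma braidInvImage_of_ne {i j : I} (hij : i ≠ j) (m : ℤ) : D.braidInvImage i j m =
    D.braidScalar i (D.negC i j) •
      rqad (D.qi i) (qPow (D.form i j)) (D.y i m) (D.negC i j) (D.y j m) := by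
  rw [braidInvImage, if_neg hij]
  split_ifs with hC
  · have : D.negC i j = 0 := by have := negC_cast (D := D) hij; lia
    simp [this]
  · rw [braidScalar, mul_inv, mul_comm, mul_smul, (D.generic_qi i).rqad_eq_sum,
      Finset.Nat.sum_antidiagonal_eq_sum_range_succ_mk, Finset.smul_sum, Finset.smul_sum]
    refine Finset.sum_congr rfl fun k _ => ?_
    rw [yDiv_eq, yDiv_eq, smul_smul, smul_smul, eta_pow_inv_mul_coeff hij]

lemma isTopPower_braidImage {i j : I} (hij : i ≠ j) (m : ℤ) :
    IsTopPower (D.qi i) (D.eta i) (D.y i m) (D.negC i j) (D.y j m) (D.braidImage i j m) := by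
  rw [IsTopPower, ← qPow_form_eq hij, qad_y_eq_zero hij, braidImage_of_ne hij, qadDiv_apply,
    braidScalar, mul_inv_rev, mul_smul, smul_inv_smul₀ (pow_ne_zero _ (D.eta_ne_zero i))]
  exact ⟨rfl, rfl⟩

end BraidImage

end Relations

variable {i j k : I}

section BraidHom

/-! ### The braid images satisfy the defining relations -/

lemma y_next_comm (hij : i ≠ j) (k : ℤ) : D.y j k * D.y i (k + 1) =
    qPow (D.form i j) • (D.y i (k + 1) * D.y j k) := by
  rw [y_next hij.symm, form_comm]

lemma qPow_form_mul_pow_two_mul (hij : i ≠ j) :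
    qPow (D.form i j) * D.qi i ^ (2 * D.negC i j) = qPow (-D.form i j) := by
  rw [qPow_neg]
  refine eq_inv_of_mul_eq_one_left ?_
  calc _ = (qPow (D.form i j) * D.qi i ^ D.negC i j) ^ 2 := by ring
    _ = 1 := by rw [qPow_form_mul hij, one_pow]

lemma smul_mul_smul_of_comm {K B : Type*} [Field K] [Ring B] [Algebra K B] {u v : B} {κ : K}
    (h : u * v = κ • (v * u)) (c c' : K) :
    (c • u) * (c' • v) = κ • ((c' • v) * (c • u)) := by
  rw [smul_mul_smul_comm, h, smul_comm, smul_mul_smul_comm, mul_comm c]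

variable [DecidableEq I]

lemma serreSum_braidImage_self_left (hij : i ≠ j) (m : ℤ) :
    D.serreSum i j (D.braidImage i i m) (D.braidImage i j m) = 0 := by
  rw [serreSum_eq hij, braidImage_self, braidImage_of_ne hij, map_smul,
    rqad_succ_qad_eq_zero (D.y_same i m) (y_next_comm hij m) (qPow_form_mul hij), smul_zero]

lemma serreSum_braidImage_self_right (hij : i ≠ j) (m : ℤ) :
    D.serreSum j i (D.braidImage i j m) (D.braidImage i i m) = 0 := by
  have hr := qPow_form_mul (D := D) hij.symm
  have hserre := qad_y_eq_zero (D := D) hij.symm m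
  rw [serreSum_eq hij.symm, ← (D.generic_qi j).qad_eq_zero_iff _ _ _ hr, braidImage_self,
    braidImage_of_ne hij, qad_smul_left]
  rw [form_comm] at hr hserre ⊢
  rw [qad_qad_eq_zero (D.generic_qi i) (qPow_form_mul hij) hr (D.y_same i m) (y_next_comm hij m)
    (qad_y_eq_zero hij m) hserre, smul_zero]

/-- Top powers are multiplicative, so the Serre element in the braid images is the normalized top
power of the Serre element in the generators, which vanishes. -/
lemma serreSum_braidImage {k : I} (hij : i ≠ j) (hik : i ≠ k) (hjk : j ≠ k) (m : ℤ) :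
    D.serreSum j k (D.braidImage i j m) (D.braidImage i k m) = 0 := by
  have hq := D.generic_qi i
  have isTopPower_serreSum : IsTopPower (D.qi i) (D.eta i) (D.y i m)
      ((D.negC j k + 1) * D.negC i j + D.negC i k)
      (D.serreSum j k (D.y j m) (D.y k m))
      (D.serreSum j k (D.braidImage i j m) (D.braidImage i k m)) := by
    refine IsTopPower.sum _ fun s hs => IsTopPower.smul ?_ _
    have hj := isTopPower_braidImage (D := D) hij m
    have hk := isTopPower_braidImage (D := D) hik m
    convert ((hj.pow hq (D.negC j k + 1 - s)).mul hq hk).mul hq (hj.pow hq s) using 1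
    obtain ⟨t, ht⟩ := Nat.exists_eq_add_of_le (Nat.lt_succ_iff.mp (Finset.mem_range.mp hs))
    rw [ht, Nat.add_sub_cancel_left]
    ring
  rw [serreSum_y hjk] at isTopPower_serreSum
  exact isTopPower_serreSum.unique (D.eta_ne_zero i) .zero

lemma braidImage_same (hij : i ≠ j) (m : ℤ) :
    D.braidImage i j m * D.braidImage i j (m + 1) =
      D.qi j ^ 2 • (D.braidImage i j (m + 1) * D.braidImage i j m) + (1 - D.qi j ^ 2) • 1 := by
  have hr := qPow_form_mul (D := D) hij
  have hcancel : D.qi j ^ 2 * qPow (D.form i j) ^ D.negC i j * qPow (D.form i j) ^ D.negC i j *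
      D.qi i ^ (2 * D.negC i j * D.negC i j) = D.qi j ^ 2 := by
    calc _ = D.qi j ^ 2 * ((qPow (D.form i j) * D.qi i ^ D.negC i j) ^ D.negC i j) ^ 2 := by ring
      _ = D.qi j ^ 2 := by rw [hr, one_pow, one_pow, mul_one]
  have hqad := qad_mul_qad_self (D.y_same i m) (y_next_comm hij m) (D.y_same j m) (y_next hij m)
    (D.negC i j)
  rw [hcancel] at hqad
  rw [braidImage_of_ne hij, braidImage_of_ne hij, smul_mul_smul_comm, smul_mul_smul_comm, hqad,
    smul_add, smul_smul _ _ (1 : D.AHat), ← mul_assoc, ← pow_two,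
    D.braidScalar_sq_mul_prod i hr, one_mul, smul_comm]

lemma braidImage_next_left (hij : i ≠ j) (m : ℤ) :
    D.braidImage i i m * D.braidImage i j (m + 1) =
      qPow (D.form i j) • (D.braidImage i j (m + 1) * D.braidImage i i m) := by
  have hserre := qad_y_eq_zero (D := D) hij (m + 1)
  rw [qad_succ, sub_eq_zero, qPow_form_mul_pow_two_mul hij, qPow_neg,
    eq_inv_smul_iff₀ (qPow_ne_zero _)] at hserre
  rw [braidImage_self, braidImage_of_ne hij, mul_smul_comm, ← hserre, smul_mul_assoc, smul_comm]

lemma braidImage_next_right (hij : i ≠ j) (m : ℤ) :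
    D.braidImage i j m * D.braidImage i i (m + 1) =
      qPow (D.form j i) • (D.braidImage i i (m + 1) * D.braidImage i j m) := by
  have hlevel : m + 1 < m + 1 + 1 := lt_add_one _
  have hsign : (m + (m + 1 + 1) + 1).negOnePow = -1 := Int.negOnePow_odd _ ⟨m + 1, by ring⟩
  have hexp : qPow (-1 * D.form j i) * qPow (-1 * D.form i i) ^ D.negC i j =
      qPow (D.form j i) := by
    rw [← qPow_mul_nat, ← qPow_add, D.form_comm j i, form_self, form_eq hij]
    congr 1
    ring
  rw [braidImage_self, braidImage_of_ne hij, smul_mul_assoc, mul_smul_comm,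
    qad_mul_of_comm (D.y_far j i hlevel) (D.y_far i i hlevel), hsign, Units.val_neg, Units.val_one,
    hexp, smul_comm]

lemma braidImage_next {k : I} (hij : i ≠ j) (hik : i ≠ k) (hjk : j ≠ k) (m : ℤ) :
    D.braidImage i j m * D.braidImage i k (m + 1) =
      qPow (D.form j k) • (D.braidImage i k (m + 1) * D.braidImage i j m) := by
  rw [braidImage_of_ne hij, braidImage_of_ne hik]
  refine smul_mul_smul_of_comm (K := QField) (B := D.AHat) ?_ _ _
  rw [qad_mul_qad (D.y_same i m) (y_next_comm hij m) (y_next hjk m) (y_next hik m), qi_pow,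
    ← qPow_mul_nat, ← qPow_mul_nat, ← qPow_add, ← qPow_add, ← qPow_add]
  congr 2
  rw [form_eq hij, form_eq hik]
  push_cast
  ring

lemma braidImage_far_left (hij : i ≠ j) {k l : ℤ} (hkl : k + 1 < l) :
    D.braidImage i i k * D.braidImage i j l =
      qPow (((k + l + 1).negOnePow : ℤ) * D.form i j) •
        (D.braidImage i j l * D.braidImage i i k) := by
  rw [braidImage_self, braidImage_of_ne hij, mul_smul_comm, smul_mul_assoc,
    smul_comm _ (braidScalar _ _ _)]
  congr 1
  rcases eq_or_lt_of_le (Int.add_one_le_of_lt hkl) with rfl | hkl'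
  · have hsign : (k + (k + 1 + 1) + 1).negOnePow = -1 := Int.negOnePow_odd _ ⟨k + 1, by ring⟩
    rw [mul_qad_of_boson (D.y_same i (k + 1)) (y_next hij (k + 1)), qPow_form_mul_pow_two_mul hij,
      hsign, Units.val_neg, Units.val_one, neg_one_mul]
  · have hsign : (k + 1 + l + 1).negOnePow = -(k + l + 1).negOnePow := by
      rw [add_right_comm k, Int.negOnePow_succ]
    rw [mul_qad_of_comm (D.y_far i j hkl') (D.y_far i i hkl'), ← qPow_mul_nat, ← qPow_add]
    congr 2
    rw [hsign, form_self, form_eq hij, Units.val_neg]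
    ring

lemma braidImage_far_right (hij : i ≠ j) {k l : ℤ} (hkl : k + 1 < l) :
    D.braidImage i j k * D.braidImage i i l =
      qPow (((k + l + 1).negOnePow : ℤ) * D.form j i) •
        (D.braidImage i i l * D.braidImage i j k) := by
  have hkl' : k + 1 < l + 1 := hkl.trans (lt_add_one l)
  have hsign : (k + (l + 1) + 1).negOnePow = -(k + l + 1).negOnePow := by
    rw [← add_assoc, Int.negOnePow_succ]
  rw [braidImage_self, braidImage_of_ne hij, smul_mul_assoc, mul_smul_comm,
    smul_comm _ (braidScalar _ _ _)]
  congr 1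
  rw [qad_mul_of_comm (D.y_far j i hkl') (D.y_far i i hkl'), ← qPow_mul_nat, ← qPow_add]
  congr 2
  rw [hsign, form_self, D.form_comm j i, form_eq hij, Units.val_neg]
  ring

lemma braidImage_far {j' : I} (hij : i ≠ j) (hij' : i ≠ j') {k l : ℤ} (hkl : k + 1 < l) :
    D.braidImage i j k * D.braidImage i j' l =
      qPow (((k + l + 1).negOnePow : ℤ) * D.form j j') •
        (D.braidImage i j' l * D.braidImage i j k) := by
  rw [braidImage_of_ne hij, braidImage_of_ne hij']
  refine smul_mul_smul_of_comm (K := QField) (B := D.AHat) ?_ _ _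
  rw [mul_qad_of_comm (qad_mul_of_comm (D.y_far j j' hkl) (D.y_far i j' hkl) _)
    (qad_mul_of_comm (D.y_far j i hkl) (D.y_far i i hkl) _)]
  simp only [← qPow_mul_nat, ← qPow_add]
  congr 2
  rw [form_self, D.form_comm j i, form_eq hij, form_eq hij']
  ring

variable (D) in
lemma isSolution_braidImage (i : I) : D.IsSolution (D.braidImage i) where
  serre j k m hjk := by
    rcases eq_or_ne i j with rfl | hij
    · exact serreSum_braidImage_self_left hjk m
    rcases eq_or_ne i k with rfl | hik
    · exact serreSum_braidImage_self_right hij m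
    exact serreSum_braidImage hij hik hjk m
  same j m := by
    rcases eq_or_ne i j with rfl | hij
    · simp only [braidImage_self, D.y_same i (m + 1)]
    exact braidImage_same hij m
  next j k m hjk := by
    rcases eq_or_ne i j with rfl | hij
    · exact braidImage_next_left hjk m
    rcases eq_or_ne i k with rfl | hik
    · exact braidImage_next_right hij m
    exact braidImage_next hij hik hjk m
  far j k m l hml := by
    rcases eq_or_ne i j with rfl | hij
    · rcases eq_or_ne i k with rfl | hik
      · have hsign : (m + 1 + (l + 1) + 1).negOnePow = (m + l + 1).negOnePow := by
          rw [add_add_add_comm, add_right_comm, Int.negOnePow_add _ (1 + 1),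
            Int.negOnePow_even _ ⟨1, rfl⟩, mul_one]
        rw [braidImage_self, braidImage_self, D.y_far i i (add_lt_add_left hml 1), hsign]
      · exact braidImage_far_left hik hml
    rcases eq_or_ne i k with rfl | hik
    · exact braidImage_far_right hij hml
    exact braidImage_far hij hik hml

variable (D) in
/-- The endomorphism `T_i` of `Â_q(𝔫)`. -/
def braidHom (i : I) : D.AHat →ₐ[QField] D.AHat := (D.isSolution_braidImage i).lift

@[simp] lemma braidHom_y (i j : I) (m : ℤ) : D.braidHom i (D.y j m) = D.braidImage i j m :=
  IsSolution.lift_y _ _ _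

end BraidHom

section BraidEquiv

/-! ### The anti-automorphism reversing the levels -/

lemma serreSum_op_eq_zero_iff {B : Type*} [Ring B] [Algebra QField B] (hij : i ≠ j) (u v : B) :
    D.serreSum i j (MulOpposite.op u) (MulOpposite.op v) = 0 ↔ D.serreSum i j u v = 0 := by
  rw [serreSum_eq hij, serreSum_eq hij, ← op_qad, MulOpposite.op_eq_zero_iff,
    (D.generic_qi i).qad_eq_zero_iff _ _ _ (qPow_form_mul hij)]

variable (D) in
lemma isSolution_op : D.IsSolution fun i m => MulOpposite.op (D.y i (-m)) where
  serre i j k hij := (serreSum_op_eq_zero_iff hij _ _).mpr (serreSum_y hij _)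
  same i k := by
    have := congrArg MulOpposite.op (D.y_same i (-(k + 1)))
    rw [neg_add_rev, neg_add_cancel_comm] at this
    simpa using this
  next i j k hij := by
    have := congrArg MulOpposite.op (y_next_comm (D := D) hij (-(k + 1)))
    rw [neg_add_rev, neg_add_cancel_comm] at this
    simpa using this
  far i j k l hkl := by
    have hlevel : -l + 1 < -k := by lia
    have hsign : (-l + -k + 1).negOnePow = (k + l + 1).negOnePow := by
      rw [Int.negOnePow_succ, Int.negOnePow_succ, ← neg_add, Int.negOnePow_neg, add_comm]
    have := congrArg MulOpposite.op (D.y_far j i hlevel)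
    rw [hsign, form_comm] at this
    simpa using this

variable (D) in
/-- The anti-automorphism `y_{i,m} ↦ y_{i,-m}`, as a homomorphism to the opposite algebra. -/
def revHom : D.AHat →ₐ[QField] D.AHatᵐᵒᵖ := D.isSolution_op.lift

variable (D) in
/-- The anti-automorphism `y_{i,m} ↦ y_{i,-m}` of `Â_q(𝔫)`, as a linear endomorphism. It conjugates
`T_i` to `T_i⁻¹`. -/
def rev : D.AHat →ₗ[QField] D.AHat :=
  (MulOpposite.opLinearEquiv QField).symm.toLinearMap ∘ₗ D.revHom.toLinearMap

lemma op_rev (x : D.AHat) : MulOpposite.op (D.rev x) = D.revHom x := rfl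

@[simp] lemma rev_y (i : I) (m : ℤ) : D.rev (D.y i m) = D.y i (-m) :=
  congrArg MulOpposite.unop (D.isSolution_op.lift_y i m)

@[simp] lemma rev_rev (x : D.AHat) : D.rev (D.rev x) = x := by
  have hinv : (AlgHom.opComm D.revHom).comp D.revHom = AlgHom.id QField D.AHat :=
    algHom_ext fun i m => (congrArg D.rev (rev_y i m)).trans (by rw [rev_y, neg_neg]; rfl)
  exact DFunLike.congr_fun hinv x

lemma rev_qad (q r : QField) (f x : D.AHat) (s : ℕ) :
    D.rev (qad q r f s x) = rqad q r (D.rev f) s (D.rev x) := by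
  rw [← MulOpposite.op_inj, op_rev, map_qad, op_rqad, op_rev, op_rev]

lemma rev_rqad (q r : QField) (f x : D.AHat) (s : ℕ) :
    D.rev (rqad q r f s x) = qad q r (D.rev f) s (D.rev x) := by
  rw [← rev_rev (qad q r (D.rev f) s (D.rev x)), rev_qad, rev_rev, rev_rev]

/-! ### The automorphisms `T_i` -/

variable (D) in
/-- The scalar by which `T_i` maps the `s`-fold mirrored commutator of `y_{j,m}` to the
`(-c_{i,j} - s)`-fold commutator. -/
def lowerScalar (i j : I) (s : ℕ) : QField :=
  D.braidScalar i (D.negC i j) * lowerProd (D.qi i) (qPow (D.form i j)) (D.negC i j) s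

variable (D) in
lemma lowerScalar_zero (i j : I) : D.lowerScalar i j 0 = D.braidScalar i (D.negC i j) := by
  simp [lowerScalar, lowerProd]

lemma lowerScalar_mul_lowerScalar (hij : i ≠ j) {s t : ℕ} (hst : s + t = D.negC i j) :
    D.lowerScalar i j s * D.lowerScalar i j t = 1 := by
  have hr := qPow_form_mul (D := D) hij
  rw [lowerScalar, lowerScalar, mul_mul_mul_comm, ← sq, lowerProd_mul_lowerProd hr hst,
    lowerProd_self, D.braidScalar_sq_mul_prod i hr]

variable [DecidableEq I]

variable (D) in
/-- The inverse of `T_i`, defined as the conjugate of `T_i` by `rev`. -/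
def braidInvHom (i : I) : D.AHat →ₐ[QField] D.AHat :=
  (AlgHom.opComm D.revHom).comp ((AlgHom.op (D.braidHom i)).comp D.revHom)

lemma braidInvHom_apply (i : I) (x : D.AHat) :
    D.braidInvHom i x = D.rev (D.braidHom i (D.rev x)) := rfl

lemma braidInvHom_y_of_ne (hij : i ≠ j) (m : ℤ) : D.braidInvHom i (D.y j m) =
    D.braidScalar i (D.negC i j) •
      rqad (D.qi i) (qPow (D.form i j)) (D.y i m) (D.negC i j) (D.y j m) := by
  rw [braidInvHom_apply, rev_y, braidHom_y, braidImage_of_ne hij, map_smul, rev_qad, rev_y, rev_y,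
    neg_neg]

lemma braidInvHom_y (i j : I) (m : ℤ) : D.braidInvHom i (D.y j m) = D.braidInvImage i j m := by
  rcases eq_or_ne i j with rfl | hij
  · rw [braidInvHom_apply, rev_y, braidHom_y, braidImage_self, braidInvImage_self, rev_y]
    congr 1
    ring
  · rw [braidInvHom_y_of_ne hij, braidInvImage_of_ne hij]

lemma braidHom_rqad_y (hij : i ≠ j) (m : ℤ) {s t : ℕ} (hst : s + t = D.negC i j) :
    D.braidHom i (rqad (D.qi i) (qPow (D.form i j)) (D.y i m) s (D.y j m)) =
      D.lowerScalar i j s • qad (D.qi i) (qPow (D.form i j)) (D.y i m) t (D.y j m) := by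
  rw [map_rqad, braidHom_y, braidHom_y, braidImage_self, braidImage_of_ne hij, map_smul,
    rqad_qad (D.y_same i m) (y_next_comm hij m) (qPow_form_mul hij) s t hst, smul_smul, lowerScalar]

lemma braidHom_comp_braidInvHom (i : I) :
    (D.braidHom i).comp (D.braidInvHom i) = AlgHom.id QField D.AHat := by
  refine algHom_ext fun j m => ?_
  rw [AlgHom.comp_apply, AlgHom.id_apply]
  rcases eq_or_ne i j with rfl | hij
  · rw [braidInvHom_y, braidInvImage_self, braidHom_y, braidImage_self, sub_add_cancel]
  rw [braidInvHom_y_of_ne hij, map_smul, braidHom_rqad_y hij m (add_zero _), smul_smul,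
    ← lowerScalar_zero, lowerScalar_mul_lowerScalar hij (zero_add _), one_smul, qad_zero]

lemma braidInvHom_comp_braidHom (i : I) :
    (D.braidInvHom i).comp (D.braidHom i) = AlgHom.id QField D.AHat := by
  refine AlgHom.ext fun x => ?_
  have hx := DFunLike.congr_fun (braidHom_comp_braidInvHom (D := D) i) (D.rev x)
  simp only [AlgHom.comp_apply, braidInvHom_apply, rev_rev, AlgHom.id_apply] at hx ⊢
  rw [hx, rev_rev]

variable (D) in
/-- The automorphism `T_i` of `Â_q(𝔫)`. -/
def braidEquiv (i : I) : D.AHat ≃ₐ[QField] D.AHat :=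
  AlgEquiv.ofAlgHom (D.braidHom i) (D.braidInvHom i) (braidHom_comp_braidInvHom i)
    (braidInvHom_comp_braidHom i)

lemma braidEquiv_y (i j : I) (m : ℤ) : D.braidEquiv i (D.y j m) = D.braidImage i j m :=
  braidHom_y i j m

lemma braidEquiv_symm_apply (i : I) (x : D.AHat) :
    (D.braidEquiv i).symm x = D.rev (D.braidEquiv i (D.rev x)) := rfl

variable (D) in
lemma isBraidFamily_braidEquiv : D.IsBraidFamily D.braidEquiv := fun i j m =>
  ⟨braidEquiv_y i j m, braidInvHom_y i j m⟩

@[simp] lemma braidEquiv_y_self (i : I) (m : ℤ) : D.braidEquiv i (D.y i m) = D.y i (m + 1) := by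
  rw [braidEquiv_y, braidImage_self]

lemma braidEquiv_y_of_ne (hij : i ≠ j) (m : ℤ) : D.braidEquiv i (D.y j m) =
    D.braidScalar i (D.negC i j) •
      qad (D.qi i) (qPow (D.form i j)) (D.y i m) (D.negC i j) (D.y j m) := by
  rw [braidEquiv_y, braidImage_of_ne hij]

lemma braidEquiv_rqad_y (hij : i ≠ j) (m : ℤ) {s t : ℕ} (hst : s + t = D.negC i j) :
    D.braidEquiv i (rqad (D.qi i) (qPow (D.form i j)) (D.y i m) s (D.y j m)) =
      D.lowerScalar i j s • qad (D.qi i) (qPow (D.form i j)) (D.y i m) t (D.y j m) :=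
  braidHom_rqad_y hij m hst

lemma braidEquiv_symm_y_of_ne (hij : i ≠ j) (m : ℤ) : (D.braidEquiv i).symm (D.y j m) =
    D.braidScalar i (D.negC i j) •
      rqad (D.qi i) (qPow (D.form i j)) (D.y i m) (D.negC i j) (D.y j m) :=
  braidInvHom_y_of_ne hij m

lemma braidEquiv_y_of_C_eq_zero (hij : i ≠ j) (h : D.C i j = 0) (m : ℤ) :
    D.braidEquiv i (D.y j m) = D.y j m := by
  rw [braidEquiv_y_of_ne hij, negC, h, neg_zero, Int.toNat_zero, braidScalar_zero, one_smul,
    qad_zero]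

end BraidEquiv

section RankTwo

lemma lowerScalar_one_of_negC_eq_two (hij : i ≠ j) (h : D.negC i j = 2) :
    D.lowerScalar i j 1 = 1 := by
  have hr := qPow_form_mul (D := D) hij
  have hq := D.generic_qi i
  have hq0 := hq.ne_zero
  have hq1 : D.qi i ^ 2 - 1 ≠ 0 := sub_ne_zero.mpr (hq.pow_ne_one 2 two_pos)
  have hqFac := hq.qFac_ne_zero 2
  rw [h] at hr
  rw [lowerScalar, h, braidScalar,
    inv_mul_eq_one₀ (mul_ne_zero hqFac (pow_ne_zero _ (D.eta_ne_zero i))), eta_sq,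
    eq_inv_of_mul_eq_one_left hr]
  simp only [qFac, qNum, lowerProd, lowerCoeff, Finset.prod_range_succ, Finset.prod_range_zero]
  field_simp
  ring

lemma d_eq_of_negC_eq_one (hij : i ≠ j) (h : D.negC i j = 1) (hji : D.negC j i = 1) :
    D.d i = D.d j := by
  have := D.form_comm i j
  rw [form_eq hij, form_eq hij.symm, h, hji] at this
  lia

lemma braidScalar_one_mul_lowerScalar (hij : i ≠ j) (h : D.negC i j = 1) :
    D.braidScalar i 1 * D.lowerScalar i j 1 = 1 := by
  rw [← h, ← lowerScalar_zero, h, lowerScalar_mul_lowerScalar hij (by rw [h])]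

variable [DecidableEq I]

lemma braidEquiv_y_of_negC_eq_one (hij : i ≠ j) (hji : D.negC j i = 1) (m : ℤ) :
    D.braidEquiv j (D.y i m) = D.braidScalar j 1 •
      rqad (D.qi i) (qPow (D.form i j)) (D.y i m) 1 (D.y j m) := by
  rw [braidEquiv_y_of_ne hij.symm, hji, form_comm, qad_one_eq_rqad_one _ (D.qi i)]

lemma braidEquiv_qad_one (hij : i ≠ j) (hji : D.negC j i = 1) (m : ℤ) :
    D.braidEquiv j (qad (D.qi i) (qPow (D.form i j)) (D.y i m) 1 (D.y j m)) =
      D.lowerScalar j i 1 • D.y i m := by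
  rw [qad_one_eq_rqad_one _ (D.qi j), form_comm, braidEquiv_rqad_y hij.symm m (t := 0) hji.symm,
    qad_zero]

lemma braidEquiv_qad_two (hij : i ≠ j) (hji : D.negC j i = 1) (m : ℤ) :
    D.braidEquiv j (qad (D.qi i) (qPow (D.form i j)) (D.y i m) 2 (D.y j m)) =
      rqad (D.qi i) (qPow (D.form i j)) (D.y i m) 2 (D.y j m) := by
  rw [qad_two, rqad_two, map_qad, braidEquiv_qad_one hij hji, braidEquiv_y_of_negC_eq_one hij hji,
    qad_smul_left, map_smul, smul_smul, pow_one, braidScalar_one_mul_lowerScalar hij.symm hji,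
    one_smul, qad_one_eq_rqad_one]

lemma braidEquiv_braidEquiv_y (hij : i ≠ j) (hji : D.negC j i = 1) (m : ℤ) {t : ℕ}
    (ht : 1 + t = D.negC i j) : D.braidEquiv i (D.braidEquiv j (D.y i m)) =
      (D.braidScalar j 1 * D.lowerScalar i j 1) •
        qad (D.qi i) (qPow (D.form i j)) (D.y i m) t (D.y j m) := by
  rw [braidEquiv_y_of_negC_eq_one hij hji, map_smul, braidEquiv_rqad_y hij m ht, smul_smul]

lemma braidEquiv_alternate_two_y (hij : i ≠ j) (h : D.negC i j = 1) (hji : D.negC j i = 1)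
    (m : ℤ) : D.braidEquiv i (D.braidEquiv j (D.y i m)) = D.y j m := by
  have hscalar : D.braidScalar j 1 = D.braidScalar i 1 := by
    simp only [braidScalar, eta, qDiff, qi, d_eq_of_negC_eq_one hij h hji]
  rw [braidEquiv_braidEquiv_y hij hji m (t := 0) h.symm, hscalar,
    braidScalar_one_mul_lowerScalar hij h, one_smul, qad_zero]

lemma braidEquiv_alternate_three_y_left (hij : i ≠ j) (h : D.negC i j = 2) (hji : D.negC j i = 1)
    (m : ℤ) : D.braidEquiv j (D.braidEquiv i (D.braidEquiv j (D.y i m))) = D.y i m := by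
  rw [braidEquiv_braidEquiv_y hij hji m (t := 1) h.symm, map_smul, braidEquiv_qad_one hij hji,
    lowerScalar_one_of_negC_eq_two hij h, mul_one, smul_smul,
    braidScalar_one_mul_lowerScalar hij.symm hji, one_smul]

lemma braidEquiv_alternate_three_y_right (hij : i ≠ j) (h : D.negC i j = 2) (hji : D.negC j i = 1)
    (m : ℤ) : D.braidEquiv i (D.braidEquiv j (D.braidEquiv i (D.y j m))) = D.y j m := by
  rw [← AlgEquiv.eq_symm_apply, braidEquiv_symm_y_of_ne hij, braidEquiv_y_of_ne hij, h, map_smul,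
    braidEquiv_qad_two hij hji]

lemma braidEquiv_symm_braidEquiv_symm_y (i j k : I) (m : ℤ) :
    (D.braidEquiv i).symm ((D.braidEquiv j).symm (D.y k m)) =
      D.rev (D.braidEquiv i (D.braidEquiv j (D.y k (-m)))) := by
  rw [braidEquiv_symm_apply, braidEquiv_symm_apply, rev_rev, rev_y]

lemma braidEquiv_alternate_five_y_left (hij : i ≠ j) (h : D.negC i j = 3) (hji : D.negC j i = 1)
    (m : ℤ) : D.braidEquiv j (D.braidEquiv i (D.braidEquiv j (D.braidEquiv i
      (D.braidEquiv j (D.y i m))))) = D.y i m := by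
  rw [← AlgEquiv.eq_symm_apply, ← AlgEquiv.eq_symm_apply, braidEquiv_symm_braidEquiv_symm_y,
    braidEquiv_braidEquiv_y hij hji _ (t := 2) h.symm,
    braidEquiv_braidEquiv_y hij hji _ (t := 2) h.symm, map_smul, map_smul,
    braidEquiv_qad_two hij hji, rev_qad, rev_y, rev_y, neg_neg]

lemma braidEquiv_braidEquiv_y_of_negC_eq_three (hij : i ≠ j) (h : D.negC i j = 3)
    (hji : D.negC j i = 1) (m : ℤ) : D.braidEquiv j (D.braidEquiv i (D.y j m)) =
      (D.braidScalar i 3 * D.braidScalar j 1) • qad 1 (qPow (D.form i j) * D.qi i ^ 4)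
        (rqad (D.qi i) (qPow (D.form i j)) (D.y i m) 1 (D.y j m)) 1
        (rqad (D.qi i) (qPow (D.form i j)) (D.y i m) 2 (D.y j m)) := by
  have qad_three : qad (D.qi i) (qPow (D.form i j)) (D.y i m) 3 (D.y j m) =
      qad 1 (qPow (D.form i j) * D.qi i ^ 4) (D.y i m) 1
        (qad (D.qi i) (qPow (D.form i j)) (D.y i m) 2 (D.y j m)) := by
    rw [qad_succ, qad_one]
  rw [braidEquiv_y_of_ne hij, h, qad_three, map_smul, map_qad, braidEquiv_qad_two hij hji,
    braidEquiv_y_of_negC_eq_one hij hji, qad_smul_left, smul_smul, pow_one]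

/-- Up to a scalar, `T_j T_i (y_{j,m})` is a commutator of `[y_i, y_j]` and `[y_i, [y_i, y_j]]`.
Both `T_i` and `rev` exchange these two elements up to mirroring, and the scalars produced by `T_i`
are inverse to each other. -/
lemma braidEquiv_alternate_five_y_right (hij : i ≠ j) (h : D.negC i j = 3) (hji : D.negC j i = 1)
    (m : ℤ) : D.braidEquiv i (D.braidEquiv j (D.braidEquiv i (D.braidEquiv j
      (D.braidEquiv i (D.y j m))))) = D.y j m := by
  have hscalar : D.lowerScalar i j 1 * D.lowerScalar i j 2 = 1 :=
    lowerScalar_mul_lowerScalar hij h.symm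
  rw [← AlgEquiv.eq_symm_apply, ← AlgEquiv.eq_symm_apply, braidEquiv_symm_braidEquiv_symm_y,
    braidEquiv_braidEquiv_y_of_negC_eq_three hij h hji,
    braidEquiv_braidEquiv_y_of_negC_eq_three hij h hji, map_smul, map_smul, map_qad,
    braidEquiv_rqad_y hij m (t := 2) h.symm, braidEquiv_rqad_y hij m (t := 1) h.symm,
    qad_smul_left, map_smul, smul_smul (_ ^ 1), pow_one, hscalar, one_smul, rev_qad, rev_rqad,
    rev_rqad, rev_y, rev_y, neg_neg, ← qad_one_eq_rqad_one]

end RankTwo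

section BraidRelations

lemma C_eq_neg_negC (hij : i ≠ j) : D.C i j = -D.negC i j := by rw [negC_cast hij, neg_neg]

lemma negC_eq_zero_iff (hij : i ≠ j) : D.negC i j = 0 ↔ D.C i j = 0 := by
  rw [C_eq_neg_negC hij, neg_eq_zero, Nat.cast_eq_zero]

lemma negC_cases (hij : i ≠ j) : (D.negC i j = 0 ∧ D.negC j i = 0) ∨
    (D.negC i j = 1 ∧ D.negC j i = 1) ∨ (D.negC i j = 1 ∧ D.negC j i = 2) ∨
    (D.negC i j = 2 ∧ D.negC j i = 1) ∨ (D.negC i j = 1 ∧ D.negC j i = 3) ∨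
    (D.negC i j = 3 ∧ D.negC j i = 1) := by
  have := D.cartan_cases hij
  rw [C_eq_neg_negC hij, C_eq_neg_negC hij.symm] at this
  lia

lemma negC_mul_negC_add_lt_four (hij : i ≠ j) (hik : i ≠ k) (hjk : j ≠ k) :
    D.negC i j * D.negC j i + D.negC j k * D.negC k j < 4 := by
  have := D.C_mul_C_add_C_mul_C_lt_four hij hik hjk
  simp only [C_eq_neg_negC hij, C_eq_neg_negC hij.symm, C_eq_neg_negC hjk,
    C_eq_neg_negC hjk.symm, neg_mul_neg] at this
  exact_mod_cast this

lemma negC_eq_one_of_two (hij : i ≠ j) (hik : i ≠ k) (hjk : j ≠ k)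
    (h : D.negC i j * D.negC j i = 2) (hC : D.C j k ≠ 0) : D.negC j k = 1 := by
  have hlt := negC_mul_negC_add_lt_four (D := D) hij hik hjk
  rw [Ne, ← negC_eq_zero_iff hjk] at hC
  rcases negC_cases (D := D) hjk with h' | h' | h' | h' | h' | h' <;>
    rw [h, h'.1, h'.2] at hlt <;> lia

lemma C_eq_zero_of_three (hij : i ≠ j) (hik : i ≠ k) (hjk : j ≠ k)
    (h : D.negC i j * D.negC j i = 3) : D.C j k = 0 := by
  have hlt := negC_mul_negC_add_lt_four (D := D) hij hik hjk
  rw [← negC_eq_zero_iff hjk]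
  rcases negC_cases (D := D) hjk with h' | h' | h' | h' | h' | h' <;>
    rw [h, h'.1, h'.2] at hlt <;> lia

lemma C_eq_zero_or_C_eq_zero (hij : i ≠ j) (hik : i ≠ k) (hjk : j ≠ k) (h : D.negC i j ≠ 0) :
    D.C i k = 0 ∨ D.C j k = 0 := by
  by_contra! hC
  exact hC.1 (D.C_eq_zero_of_ne_zero_of_ne_zero hij hik hjk ((negC_eq_zero_iff hij).not.mp h) hC.2)

lemma braidOrder_eq (hij : i ≠ j) : D.braidOrder i j =
    if D.negC i j * D.negC j i = 0 then 2 else if D.negC i j * D.negC j i = 1 then 3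
    else if D.negC i j * D.negC j i = 2 then 4 else 6 := by
  rw [braidOrder, C_eq_neg_negC hij, C_eq_neg_negC hij.symm, neg_mul_neg]
  norm_cast

lemma commute_y (hij : i ≠ j) (h : D.C i j = 0) (m : ℤ) : Commute (D.y i m) (D.y j m) := by
  have hnegC := (negC_eq_zero_iff (D := D) hij).mpr h
  have hr := qPow_form_mul (D := D) hij
  have hcomm := qad_y_eq_zero (D := D) hij m
  rw [hnegC, pow_zero, mul_one] at hr
  rw [hnegC, zero_add, qad_one, hr, one_smul, sub_eq_zero] at hcomm
  exact hcomm.symm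

lemma algEquiv_ext {S T : D.AHat ≃ₐ[QField] D.AHat} (h : ∀ i m, S (D.y i m) = T (D.y i m)) :
    S = T :=
  AlgEquiv.coe_toAlgHom_injective (algHom_ext h)

variable [DecidableEq I]

lemma braidEquiv_mul_comm (hij : i ≠ j) (h : D.C i j = 0) :
    D.braidEquiv i * D.braidEquiv j = D.braidEquiv j * D.braidEquiv i := by
  have h' : D.C j i = 0 := C_eq_zero_symm h
  refine algEquiv_ext fun k m => ?_
  simp only [AlgEquiv.mul_apply]
  rcases eq_or_ne i k with rfl | hik
  · simp only [braidEquiv_y_of_C_eq_zero hij.symm h', braidEquiv_y_self]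
  rcases eq_or_ne j k with rfl | hjk
  · simp only [braidEquiv_y_of_C_eq_zero hij h, braidEquiv_y_self]
  rw [braidEquiv_y_of_ne hjk, braidEquiv_y_of_ne hik, map_smul, map_smul, map_qad, map_qad,
    braidEquiv_y_of_C_eq_zero hij h, braidEquiv_y_of_C_eq_zero hij.symm h',
    braidEquiv_y_of_ne hjk, braidEquiv_y_of_ne hik, map_smul, map_smul, smul_comm,
    qad_qad_comm (commute_y hij h m)]

/-- Since `T_j T_i (y_j) = y_i`, the right side is an iterated commutator of `y_i` with one of `y_j`
and `y_k`. It is a top one, so it amounts to replacing `y_j` by `T_i (y_j)`. -/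
lemma braidEquiv_braid_three_y (hij : i ≠ j) (hik : i ≠ k) (hjk : j ≠ k) (h : D.negC i j = 1)
    (hji : D.negC j i = 1) (hk : D.C i k = 0) (m : ℤ) :
    D.braidEquiv i (D.braidEquiv j (D.braidEquiv i (D.y k m))) =
      D.braidEquiv j (D.braidEquiv i (D.braidEquiv j (D.y k m))) := by
  have hd := d_eq_of_negC_eq_one hij h hji
  have hq : D.qi i = D.qi j := by rw [qi, qi, hd]
  have hη : D.eta i = D.eta j := by rw [eta, eta, qDiff, qDiff, hd]
  have hTij := isTopPower_braidImage (D := D) hij m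
  have hTik := isTopPower_braidImage (D := D) hik m
  rw [← braidEquiv_y, h] at hTij
  rw [← braidEquiv_y, braidEquiv_y_of_C_eq_zero hik hk, (negC_eq_zero_iff hik).mpr hk] at hTik
  have htop := (hTij.qad (D.generic_qi i) hTik (D.qi j) (qPow (D.form j k)) (D.negC j k)).1
  rw [mul_one, zero_add, hq, hη, ← qPow_form_eq hjk, qadDiv_apply,
    inv_smul_eq_iff₀ ((D.generic_qi j).qFac_ne_zero _), smul_smul] at htop
  rw [braidEquiv_y_of_C_eq_zero hik hk, braidEquiv_y_of_ne hjk, map_smul, map_smul,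
    map_qad, map_qad, braidEquiv_y_of_C_eq_zero hik hk,
    braidEquiv_alternate_two_y hij.symm hji h, braidEquiv_y_of_ne hjk, map_smul, htop, braidScalar,
    inv_smul_smul₀ (D.qFac_mul_eta_pow_ne_zero j _)]

lemma braidEquiv_braid_three (hij : i ≠ j) (h : D.negC i j = 1) (hji : D.negC j i = 1) :
    D.braidEquiv i * (D.braidEquiv j * D.braidEquiv i) =
      D.braidEquiv j * (D.braidEquiv i * D.braidEquiv j) := by
  refine algEquiv_ext fun k m => ?_
  simp only [AlgEquiv.mul_apply]
  rcases eq_or_ne i k with rfl | hik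
  · simp only [braidEquiv_alternate_two_y hij h hji, braidEquiv_y_self]
  rcases eq_or_ne j k with rfl | hjk
  · simp only [braidEquiv_alternate_two_y hij.symm hji h, braidEquiv_y_self]
  rcases C_eq_zero_or_C_eq_zero (D := D) hij hik hjk (by lia) with hk | hk
  · exact braidEquiv_braid_three_y hij hik hjk h hji hk m
  · exact (braidEquiv_braid_three_y hij.symm hjk hik hji h hk m).symm

lemma braidEquiv_braid_four_y (hik : i ≠ k) (hjk : j ≠ k) (hj : D.C j k = 0)
    (hi : D.negC i k = 1) (m : ℤ)
    (hfix : D.braidEquiv j (D.braidEquiv i (D.braidEquiv j (D.y i m))) = D.y i m)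
    (hqad : qad (D.qi i) (qPow (D.form i k)) ((D.braidEquiv j).symm (D.y i m)) 1
        (qad (D.qi i) (qPow (D.form i k)) (D.y i m) 1 (D.y k m)) =
      qad (D.qi i) (qPow (D.form i k)) (D.y i m) 1
        (qad (D.qi i) (qPow (D.form i k)) (D.braidEquiv j (D.y i m)) 1 (D.y k m))) :
    D.braidEquiv i (D.braidEquiv j (D.braidEquiv i (D.braidEquiv j (D.y k m)))) =
      D.braidEquiv j (D.braidEquiv i (D.braidEquiv j (D.braidEquiv i (D.y k m)))) := by
  have hsymm : D.braidEquiv i (D.braidEquiv j (D.y i m)) = (D.braidEquiv j).symm (D.y i m) := by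
    rw [AlgEquiv.eq_symm_apply, hfix]
  have hTi := braidEquiv_y_of_ne (D := D) hik m
  rw [hi] at hTi
  have hTj := braidEquiv_y_of_C_eq_zero (D := D) hjk hj m
  have hTiji : D.braidEquiv i (D.braidEquiv j (D.braidEquiv i (D.y k m))) =
      D.braidScalar i 1 • D.braidScalar i 1 • qad (D.qi i) (qPow (D.form i k))
        ((D.braidEquiv j).symm (D.y i m)) 1
        (qad (D.qi i) (qPow (D.form i k)) (D.y i m) 1 (D.y k m)) := by
    simp only [hTj, hTi, map_smul, map_qad, hsymm]
  rw [hTj, hTiji]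
  simp only [map_smul, map_qad, AlgEquiv.apply_symm_apply, hTj]
  rw [hqad]

lemma braidEquiv_braid_four_y_of_short (hij : i ≠ j) (hik : i ≠ k) (hjk : j ≠ k)
    (h : D.negC i j = 2) (hji : D.negC j i = 1) (hk : D.C j k = 0) (hi : D.C i k ≠ 0) (m : ℤ) :
    D.braidEquiv i (D.braidEquiv j (D.braidEquiv i (D.braidEquiv j (D.y k m)))) =
      D.braidEquiv j (D.braidEquiv i (D.braidEquiv j (D.braidEquiv i (D.y k m)))) := by
  have hik1 : D.negC i k = 1 := negC_eq_one_of_two hij.symm hjk hik (by rw [h, hji]) hi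
  have hr := qPow_form_mul (D := D) hij
  have hp := qPow_form_mul (D := D) hik
  have hS := qad_y_eq_zero (D := D) hik m
  rw [h] at hr
  rw [hik1] at hp hS
  rw [pow_one] at hp
  refine braidEquiv_braid_four_y hik hjk hk hik1 m
    (braidEquiv_alternate_three_y_left hij h hji m) ?_
  rw [braidEquiv_symm_y_of_ne hij.symm, braidEquiv_y_of_ne hij.symm, hji, qad_smul_left,
    qad_smul_left, map_smul, D.form_comm j i,
    qad_rqad_eq_of_short hp hr (commute_y hjk.symm (C_eq_zero_symm hk) m) hS]

lemma braidEquiv_braid_four_y_of_long (hij : i ≠ j) (hik : i ≠ k) (hjk : j ≠ k)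
    (h : D.negC i j = 2) (hji : D.negC j i = 1) (hk : D.C i k = 0) (hj : D.C j k ≠ 0) (m : ℤ) :
    D.braidEquiv j (D.braidEquiv i (D.braidEquiv j (D.braidEquiv i (D.y k m)))) =
      D.braidEquiv i (D.braidEquiv j (D.braidEquiv i (D.braidEquiv j (D.y k m)))) := by
  have hjk1 : D.negC j k = 1 := negC_eq_one_of_two hij hik hjk (by rw [h, hji]) hj
  have hr := qPow_form_mul (D := D) hij
  have hp := qPow_form_mul (D := D) hij.symm
  have hform : qPow (D.form j k) = qPow (D.form i j) := by
    rw [D.form_comm i j, qPow_form_eq hjk, qPow_form_eq hij.symm, hjk1, hji]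
  have hS := qad_y_eq_zero (D := D) hjk m
  have hR := qad_y_eq_zero (D := D) hij.symm m
  rw [h] at hr
  rw [hji, D.form_comm j i] at hR hp
  rw [pow_one] at hp
  rw [hjk1, hform] at hS
  have hp2 : 1 + qPow (D.form i j) ^ 2 ≠ 0 := fun h0 =>
    (D.generic_qi j).pow_ne_one 4 (by norm_num) (by
      have h4 : (qPow (D.form i j) * D.qi j) ^ 4 = 1 := by rw [hp, one_pow]
      linear_combination h4 - D.qi j ^ 4 * (qPow (D.form i j) ^ 2 - 1) * h0)
  refine braidEquiv_braid_four_y hjk hik hk hjk1 m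
    (braidEquiv_alternate_three_y_right hij h hji m) ?_
  rw [braidEquiv_symm_y_of_ne hij, braidEquiv_y_of_ne hij, h, qad_smul_left, qad_smul_left,
    map_smul, hform,
    qad_rqad_eq_of_long hp hr hp2 (commute_y hik.symm (C_eq_zero_symm hk) m) hS hR]

lemma braidEquiv_braid_four (hij : i ≠ j) (h : D.negC i j = 2) (hji : D.negC j i = 1) :
    D.braidEquiv i * (D.braidEquiv j * (D.braidEquiv i * D.braidEquiv j)) =
      D.braidEquiv j * (D.braidEquiv i * (D.braidEquiv j * D.braidEquiv i)) := by
  refine algEquiv_ext fun k m => ?_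
  simp only [AlgEquiv.mul_apply]
  rcases eq_or_ne i k with rfl | hik
  · simp only [braidEquiv_alternate_three_y_left hij h hji, braidEquiv_y_self]
  rcases eq_or_ne j k with rfl | hjk
  · simp only [braidEquiv_alternate_three_y_right hij h hji, braidEquiv_y_self]
  by_cases hi : D.C i k = 0
  · by_cases hj : D.C j k = 0
    · simp only [braidEquiv_y_of_C_eq_zero hik hi, braidEquiv_y_of_C_eq_zero hjk hj]
    exact (braidEquiv_braid_four_y_of_long hij hik hjk h hji hi hj m).symm
  · have hj := (C_eq_zero_or_C_eq_zero hij hik hjk (by lia)).resolve_left hi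
    exact braidEquiv_braid_four_y_of_short hij hik hjk h hji hj hi m

lemma braidEquiv_braid_six (hij : i ≠ j) (h : D.negC i j = 3) (hji : D.negC j i = 1) :
    D.braidEquiv i * (D.braidEquiv j * (D.braidEquiv i * (D.braidEquiv j *
      (D.braidEquiv i * D.braidEquiv j)))) =
      D.braidEquiv j * (D.braidEquiv i * (D.braidEquiv j * (D.braidEquiv i *
      (D.braidEquiv j * D.braidEquiv i)))) := by
  refine algEquiv_ext fun k m => ?_
  simp only [AlgEquiv.mul_apply]
  rcases eq_or_ne i k with rfl | hik
  · simp only [braidEquiv_alternate_five_y_left hij h hji, braidEquiv_y_self]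
  rcases eq_or_ne j k with rfl | hjk
  · simp only [braidEquiv_alternate_five_y_right hij h hji, braidEquiv_y_self]
  have hj := C_eq_zero_of_three (D := D) hij hik hjk (by rw [h, hji])
  have hi := C_eq_zero_of_three (D := D) hij.symm hjk hik (by rw [h, hji])
  simp only [braidEquiv_y_of_C_eq_zero hik hi, braidEquiv_y_of_C_eq_zero hjk hj]

lemma braidRelations_braidEquiv : D.BraidRelations D.braidEquiv := by
  intro i j hij
  rw [braidOrder_eq hij]
  rcases negC_cases (D := D) hij with ⟨h, h'⟩ | ⟨h, h'⟩ | ⟨h, h'⟩ | ⟨h, h'⟩ | ⟨h, h'⟩ | ⟨h, h'⟩ <;>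
    rw [h, h'] <;> norm_num [alternatingWord, mul_assoc]
  · exact braidEquiv_mul_comm hij ((negC_eq_zero_iff hij).mp h)
  · exact (braidEquiv_braid_three hij h h').symm
  · exact (braidEquiv_braid_four hij.symm h' h).symm
  · exact braidEquiv_braid_four hij h h'
  · exact (braidEquiv_braid_six hij.symm h' h).symm
  · exact braidEquiv_braid_six hij h h'

lemma prod_alternatingWord_braidEquiv_y (m : ℤ) (i j : I) (hij : i ≠ j) :
    ((alternatingWord i j (D.braidOrder i j - 1)).map D.braidEquiv).prod (D.y i m) =
      D.y (if D.braidOrder i j = 3 then j else i) m := by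
  rw [braidOrder_eq hij]
  rcases negC_cases (D := D) hij with ⟨h, h'⟩ | ⟨h, h'⟩ | ⟨h, h'⟩ | ⟨h, h'⟩ | ⟨h, h'⟩ | ⟨h, h'⟩ <;>
    rw [h, h'] <;> norm_num [alternatingWord]
  · exact braidEquiv_y_of_C_eq_zero hij.symm ((negC_eq_zero_iff hij.symm).mp h') m
  · exact braidEquiv_alternate_two_y hij h h' m
  · exact braidEquiv_alternate_three_y_right hij.symm h' h m
  · exact braidEquiv_alternate_three_y_left hij h h' m
  · exact braidEquiv_alternate_five_y_right hij.symm h' h m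
  · exact braidEquiv_alternate_five_y_left hij h h' m

end BraidRelations

section Words

lemma y_mem_level (i : I) (m : ℤ) : D.y i m ∈ D.level m := Algebra.subset_adjoin ⟨i, rfl⟩

variable [DecidableEq I]

lemma braidInvWord_braidEquiv_apply (l : List I) (x : D.AHat) :
    D.braidInvWord D.braidEquiv l x = D.rev (D.braidWord D.braidEquiv l (D.rev x)) := by
  induction l generalizing x with
  | nil => exact (rev_rev x).symm
  | cons i l ih =>
    simp only [braidInvWord, braidWord, List.map_cons, List.prod_cons, AlgEquiv.mul_apply] at ih ⊢
    rw [ih, braidEquiv_symm_apply, rev_rev]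

lemma braidWord_braidEquiv_y {l : List I} (hl : D.IsReduced (l ++ [i]))
    (h : D.wordProd l (D.simpleRoot i) = D.simpleRoot j) (m : ℤ) :
    D.braidWord D.braidEquiv l (D.y i m) = D.y j m :=
  braidRelations_braidEquiv.prod_map_smul_eq (D.y · m) (prod_alternatingWord_braidEquiv_y m) hl h

lemma braidInvWord_braidEquiv_y {l : List I} (hl : D.IsReduced (l ++ [i]))
    (h : D.wordProd l (D.simpleRoot i) = D.simpleRoot j) (m : ℤ) :
    D.braidInvWord D.braidEquiv l (D.y i m) = D.y j m := by
  rw [braidInvWord_braidEquiv_apply, rev_y, braidWord_braidEquiv_y hl h, rev_y, neg_neg]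

lemma IsLongest.braidWord_braidEquiv_y {w : (I → ℤ) ≃ₗ[ℤ] (I → ℤ)} {l : List I}
    (hw : D.IsLongest w) (hl : D.IsReducedWord w l)
    (h : w (D.simpleRoot i) = -D.simpleRoot j) (m : ℤ) :
    D.braidWord D.braidEquiv l (D.y i m) = D.y j (m + 1) := by
  obtain ⟨p, hp⟩ := hw.exists_isReducedWord_append_singleton i
  have hpij : D.wordProd p (D.simpleRoot i) = D.simpleRoot j := by
    rwa [← hp.1, wordProd_append_singleton, LinearEquiv.mul_apply,
      simpleReflection_simpleRoot_self, map_neg, neg_inj] at h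
  rw [braidWord, braidRelations_braidEquiv.prod_map_eq hl hp, List.map_append, List.prod_append,
    List.map_singleton, List.prod_singleton, AlgEquiv.mul_apply, braidEquiv_y_self]
  exact SimpleCartanDatum.braidWord_braidEquiv_y hp.isReduced hpij (m + 1)

lemma IsLongest.braidInvWord_braidEquiv_y {w : (I → ℤ) ≃ₗ[ℤ] (I → ℤ)} {l : List I}
    (hw : D.IsLongest w) (hl : D.IsReducedWord w l)
    (h : w (D.simpleRoot i) = -D.simpleRoot j) (m : ℤ) :
    D.braidInvWord D.braidEquiv l (D.y i m) = D.y j (m - 1) := by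
  rw [braidInvWord_braidEquiv_apply, rev_y, hw.braidWord_braidEquiv_y hl h, rev_y, neg_add, neg_neg,
    sub_eq_add_neg]

end Words

end SimpleCartanDatum

end

theorem mainTheorem9 {I : Type*} [Fintype I] [DecidableEq I] (D : SimpleCartanDatum I) :
    ∃ T : I → (D.AHat ≃ₐ[SimpleCartanDatum.QField] D.AHat), D.IsBraidFamily T ∧
      (∀ (w : (I → ℤ) ≃ₗ[ℤ] (I → ℤ)) (l : List I) (i j : I),
        D.IsReducedWord w (l ++ [i]) →
        D.wordProd l (D.simpleRoot i) = D.simpleRoot j →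
        ∀ m : ℤ, D.braidWord T l (D.y i m) = D.y j m ∧
          D.braidInvWord T l (D.y i m) = D.y j m) ∧
      (∀ w₀ : (I → ℤ) ≃ₗ[ℤ] (I → ℤ), D.IsLongest w₀ →
        ∃ star : I → I, (∀ i, w₀ (D.simpleRoot i) = -D.simpleRoot (star i)) ∧
          ∀ l : List I, D.IsReducedWord w₀ l → ∀ (i : I) (m : ℤ),
            (D.braidWord T l (D.y i m) = D.y (star i) (m + 1) ∧
              D.y (star i) (m + 1) ∈ D.level (m + 1)) ∧
            (D.braidInvWord T l (D.y i m) = D.y (star i) (m - 1) ∧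
              D.y (star i) (m - 1) ∈ D.level (m - 1))) := by
  refine ⟨D.braidEquiv, D.isBraidFamily_braidEquiv, fun w l i j hl h m => ?_, fun w₀ hw => ?_⟩
  · exact ⟨SimpleCartanDatum.braidWord_braidEquiv_y hl.isReduced h m,
      SimpleCartanDatum.braidInvWord_braidEquiv_y hl.isReduced h m⟩
  · choose star hstar using hw.exists_apply_simpleRoot_eq_neg
    refine ⟨star, hstar, fun l hl i m => ⟨⟨?_, ?_⟩, ?_, ?_⟩⟩
    · exact hw.braidWord_braidEquiv_y hl (hstar i) m
    · exact SimpleCartanDatum.y_mem_level _ _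
    · exact hw.braidInvWord_braidEquiv_y hl (hstar i) m
    · exact SimpleCartanDatum.y_mem_level _ _
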